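/- Let $R$ and $S$ be associative rings with unit; modules are unital left modules, and right $R$-modules are left $R^{op}$-modules. Let $d\ge 1$ be an integer and let $n$ be an integer with $n>d+1$, or $n=\infty$. For a ring $A$, an $A$-module $U$ is \emph{finitely $n$-presented} if there is an exact sequence $F_n\to F_{n-1}\to\cdots\to F_0\to U\to 0$ with all $F_i$ finitely generated free; for $n=\infty$ (\emph{super finitely presented}) the sequence is infinite, $\cdots\to F_1\to F_0\to U\to 0$. An $S$-module $I$ is \emph{$(n,d)$-injective} if $\mathrm{Ext}_S^{d+1}(U,I)=0$ for every finitely $n$-presented $S$-module $U$. An $R$-module $F$ is \emph{$(n,d)$-flat} if $\mathrm{Tor}^R_{d+1}(U,F)=0$ for every finitely $n$-presented $R^{op}$-module $U$. An $(S,R)$-bimodule $K$ is \emph{semidualizing} if ${}_SK$ and $K_R$ have resolutions by finitely generated projective modules, the homothety maps $S\to\mathrm{Hom}_{R^{op}}(K,K)$ and $R\to\mathrm{Hom}_S(K,K)$ are bijective, and $\mathrm{Ext}_S^i(K,K)=0=\mathrm{Ext}_{R^{op}}^i(K,K)$ for all $i\ge 1$. Let $C$ be an $(S,R)$-bimodule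 that is super finitely presented as a left $S$-module and as a right $R$-module, and let $K_{d-1}$ be a semidualizing $(S,R)$-bimodule that is a $(d-1)$th syzygy of $C$ on both sides: as a left $S$-module it is isomorphic to $\mathrm{Ker}(F_{d-1}\to F_{d-2})$ (with $F_{-1}=C$) for some resolution $\cdots\to F_1\to F_0\to C\to 0$ of ${}_SC$ by finitely generated free modules, and likewise as a right $R$-module for some such resolution of $C_R$. An $R$-module is \emph{$K_{d-1}$-$(n,d)$-injective} if it is isomorphic to $\mathrm{Hom}_S(K_{d-1},I)$ for some $(n,d)$-injective $S$-module $I$; an $S$-module is \emph{$K_{d-1}$-$(n,d)$-flat} if it is isomorphic to $K_{d-1}\otimes_R F$ for some $(n,d)$-flat $R$-module $F$. A submodule $N\subseteq M$ of left $A$-modules is \emph{pure} if $X\otimes_A N\to X\otimes_A M$ is injective for every right $A$-module $X$, and a \emph{pure epimorphic image} of $M$ is a module $Q$ with a surjection $M\to Q$ whose kernel is a pure submodule of $M$. Then the following hold. (1) An $R$-module $M$ is $K_{d-1}$-$(n,d)$-injective if and only if every pure submodule and every pure epimorphic image of $M$ is $K_{d-1}$-$(n,d)$-injective. (2) An $S$-module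 $M$ is $K_{d-1}$-$(n,d)$-flat if and only if every pure submodule and every pure epimorphic image of $M$ is $K_{d-1}$-$(n,d)$-flat. In particular (this is the forward implication in (1) and (2)), both classes are closed under pure submodules and pure quotients. -/

import Mathlib

open CategoryTheory
open scoped TensorProduct

universe u

noncomputable section

/-! ### Finitely `n`-presented modules and syzygies -/

/-- An exact sequence `F_n → ⋯ → F_1 → F_0 → U → 0` (infinite to the left if `n = ⊤`) of left
`A`-modules with every `F_i = A ^ (rank i)` finitely generated and free.  For `n < ⊤` the data
in degrees greater than `n` is irrelevant, no condition is put on it. -/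
structure FreePresentation (A : Type u) [Ring A] (n : ℕ∞)
    (U : Type u) [AddCommGroup U] [Module A U] where
  rank : ℕ → ℕ
  aug : (Fin (rank 0) → A) →ₗ[A] U
  diff : ∀ i : ℕ, (Fin (rank (i + 1)) → A) →ₗ[A] (Fin (rank i) → A)
  aug_surjective : Function.Surjective aug
  exact_zero : 1 ≤ n → Function.Exact (diff 0) aug
  exact_succ : ∀ i : ℕ, ((i + 2 : ℕ) : ℕ∞) ≤ n → Function.Exact (diff (i + 1)) (diff i)

/-- `U` is finitely `n`-presented; for `n = ⊤` this says that `U` is super finitely presented. -/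
def IsFinitelyNPresented (A : Type u) [Ring A] (n : ℕ∞)
    (U : Type u) [AddCommGroup U] [Module A U] : Prop :=
  Nonempty (FreePresentation A n U)

/-- `K` is a `(d-1)`th syzygy `K_{d-1} = Ker (F_{d-1} → F_{d-2})` of the left `A`-module `C`
in some resolution `⋯ → F_1 → F_0 → C → 0` by finitely generated free modules, with the usual
conventions `F_{-1} = C` and `K_{-1} = C`.  In particular `C` is super finitely presented. -/
def IsSyzygy (A : Type u) [Ring A] (d : ℕ) (K C : Type u)
    [AddCommGroup K] [Module A K] [AddCommGroup C] [Module A C] : Prop :=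
  ∃ P : FreePresentation A ⊤ C,
    match d with
    | 0 => Nonempty (K ≃ₗ[A] C)
    | 1 => Nonempty (K ≃ₗ[A] LinearMap.ker P.aug)
    | m + 2 => Nonempty (K ≃ₗ[A] LinearMap.ker (P.diff m))

/-- `U` has a resolution `⋯ → P_1 → P_0 → U → 0` by finitely generated projective left
`A`-modules. -/
def HasDegreewiseFiniteProjectiveResolution (A : Type u) [Ring A]
    (U : Type u) [AddCommGroup U] [Module A U] : Prop :=
  ∃ (P : ℕ → ModuleCat.{u} A) (aug : P 0 →ₗ[A] U) (diff : ∀ i : ℕ, P (i + 1) →ₗ[A] P i),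
    (∀ i, Module.Finite A (P i)) ∧ (∀ i, Module.Projective A (P i)) ∧
    Function.Surjective aug ∧ Function.Exact (diff 0) aug ∧
    ∀ i : ℕ, Function.Exact (diff (i + 1)) (diff i)

/-! ### Semidualizing bimodules

An `(S, R)`-bimodule is a left `S`-module that is also a right `R`-module, i.e. a left
`Rᵐᵒᵖ`-module, such that the two actions commute. -/

/-- Right multiplication `x ↦ x r` on an `(S, R)`-bimodule, as an `S`-linear map. -/
def rightMul (S R K : Type u) [Ring S] [Ring R] [AddCommGroup K] [Module S K]
    [Module Rᵐᵒᵖ K] [SMulCommClass S Rᵐᵒᵖ K] (r : R) : K →ₗ[S] K where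
  toFun x := MulOpposite.op r • x
  map_add' x y := smul_add _ x y
  map_smul' s x := (smul_comm s (MulOpposite.op r) x).symm

/-- Left multiplication `x ↦ s x` on an `(S, R)`-bimodule, as an `R`-linear map. -/
def leftMul (S R K : Type u) [Ring S] [Ring R] [AddCommGroup K] [Module S K]
    [Module Rᵐᵒᵖ K] [SMulCommClass S Rᵐᵒᵖ K] (s : S) : K →ₗ[Rᵐᵒᵖ] K where
  toFun x := s • x
  map_add' x y := smul_add _ x y
  map_smul' r x := smul_comm s r x

/-- The `(S, R)`-bimodule `K` is semidualizing. The homothety maps are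
`s ↦ (x ↦ s x)` from `S` to `Hom_{R^op}(K, K)` and `r ↦ (x ↦ x r)` from `R` to `Hom_S(K, K)`. -/
structure IsSemidualizing (S R K : Type u) [Ring S] [Ring R] [AddCommGroup K]
    [Module S K] [Module Rᵐᵒᵖ K] [SMulCommClass S Rᵐᵒᵖ K] : Prop where
  resolution_left : HasDegreewiseFiniteProjectiveResolution S K
  resolution_right : HasDegreewiseFiniteProjectiveResolution Rᵐᵒᵖ K
  homothety_left :
    Function.Bijective (fun s : S => leftMul S R K s)
  homothety_right :
    Function.Bijective (fun r : R => rightMul S R K r)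
  ext_left : ∀ i : ℕ, 1 ≤ i →
    Subsingleton (Abelian.Ext (ModuleCat.of S K) (ModuleCat.of S K) i)
  ext_right : ∀ i : ℕ, 1 ≤ i →
    Subsingleton (Abelian.Ext (ModuleCat.of Rᵐᵒᵖ K) (ModuleCat.of Rᵐᵒᵖ K) i)

/-- `K` is a special semidualizing bimodule with respect to the `(S, R)`-bimodule `C`
(so that `C` is `d`-semidualizing): `K` is semidualizing, and it is a `(d-1)`th syzygy of the
super finitely presented bimodule `C`, as a left `S`-module and as a right `R`-module. -/
structure IsSpecialSemidualizing (S R : Type u) [Ring S] [Ring R] (d : ℕ) (K C : Type u)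
    [AddCommGroup K] [Module S K] [Module Rᵐᵒᵖ K]
    [SMulCommClass S Rᵐᵒᵖ K]
    [AddCommGroup C] [Module S C] [Module Rᵐᵒᵖ C] [SMulCommClass S Rᵐᵒᵖ C] : Prop where
  semidualizing : IsSemidualizing S R K
  syzygy_left : IsSyzygy S d K C
  syzygy_right : IsSyzygy Rᵐᵒᵖ d K C

/-! ### The tensor product over a noncommutative ring -/

/-- The elements `(x r) ⊗ y - x ⊗ (r y)` of `X ⊗_ℤ N`. -/
def balancedRel (R X N : Type u) [Ring R] [AddCommGroup X] [Module Rᵐᵒᵖ X]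
    [AddCommGroup N] [Module R N] : Set (X ⊗[ℤ] N) :=
  {z | ∃ (x : X) (r : R) (y : N), z = (MulOpposite.op r • x) ⊗ₜ[ℤ] y - x ⊗ₜ[ℤ] (r • y)}

/-- The tensor product `X ⊗_R N` of an `(S, R)`-bimodule `X` and a left `R`-module `N`, as a left
`S`-module. For a right `R`-module `X` take `S = ℤ`. -/
abbrev BalTensor (S : Type*) (R X N : Type u) [Ring S] [Ring R] [AddCommGroup X] [Module S X]
    [Module Rᵐᵒᵖ X] [SMulCommClass S Rᵐᵒᵖ X] [AddCommGroup N] [Module R N] : Type u :=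
  (X ⊗[ℤ] N) ⧸ Submodule.span S (balancedRel R X N)

/-- The `S`-submodule divided out in `BalTensor` is just the additive subgroup generated by the
relations. -/
theorem span_balancedRel (S : Type*) (R X N : Type u) [Ring S] [Ring R] [AddCommGroup X]
    [Module S X] [Module Rᵐᵒᵖ X] [SMulCommClass S Rᵐᵒᵖ X] [AddCommGroup N] [Module R N] :
    (Submodule.span S (balancedRel R X N)).toAddSubgroup =
      AddSubgroup.closure (balancedRel R X N) := by
  apply le_antisymm
  · intro z hz
    refine Submodule.span_induction (p := fun z _ => z ∈ AddSubgroup.closure (balancedRel R X N))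
      (fun z hz => AddSubgroup.subset_closure hz) (zero_mem _)
      (fun _ _ _ _ h₁ h₂ => add_mem h₁ h₂) ?_ hz
    intro s z _ hz
    refine AddSubgroup.closure_induction
      (p := fun z _ => s • z ∈ AddSubgroup.closure (balancedRel R X N)) ?_ ?_ ?_ ?_ hz
    · rintro _ ⟨x, r, y, rfl⟩
      apply AddSubgroup.subset_closure
      refine ⟨s • x, r, y, ?_⟩
      rw [smul_sub, TensorProduct.smul_tmul', TensorProduct.smul_tmul', smul_comm]
    · rw [smul_zero]; exact zero_mem _
    · intro a b _ _ ha hb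
      rw [smul_add]; exact add_mem ha hb
    · intro a _ ha
      rw [smul_neg]; exact neg_mem ha
  · rw [AddSubgroup.closure_le]
    exact Submodule.subset_span

/-- The map `f ⊗_R g : X ⊗_R N → X' ⊗_R N'`. -/
def balTensorMap (R : Type u) [Ring R] {X X' N N' : Type u}
    [AddCommGroup X] [Module Rᵐᵒᵖ X] [AddCommGroup X'] [Module Rᵐᵒᵖ X']
    [AddCommGroup N] [Module R N] [AddCommGroup N'] [Module R N']
    (f : X →ₗ[Rᵐᵒᵖ] X') (g : N →ₗ[R] N') :
    BalTensor ℤ R X N →ₗ[ℤ] BalTensor ℤ R X' N' :=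
  Submodule.mapQ _ _
    (TensorProduct.map f.toAddMonoidHom.toIntLinearMap g.toAddMonoidHom.toIntLinearMap) <| by
    rw [Submodule.span_le]
    rintro _ ⟨x, r, y, rfl⟩
    refine Submodule.subset_span ⟨f x, r, g y, ?_⟩
    simp

/-- Maps out of `X ⊗_R N` that agree on the elements `x ⊗ y` are equal. -/
theorem balTensor_hom_ext {R X N : Type u} [Ring R] [AddCommGroup X] [Module Rᵐᵒᵖ X]
    [AddCommGroup N] [Module R N] {Y : Type u} [AddCommGroup Y] {f g : BalTensor ℤ R X N →ₗ[ℤ] Y}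
    (h : ∀ (x : X) (y : N), f (Submodule.Quotient.mk (x ⊗ₜ[ℤ] y)) =
      g (Submodule.Quotient.mk (x ⊗ₜ[ℤ] y))) : f = g :=
  Submodule.linearMap_qext _ (TensorProduct.ext' h)

/-- The functor `- ⊗_R N` from right `R`-modules to abelian groups. -/
def balTensorFunctor (R : Type u) [Ring R] (N : Type u) [AddCommGroup N] [Module R N] :
    ModuleCat.{u} Rᵐᵒᵖ ⥤ ModuleCat.{u} ℤ where
  obj X := ModuleCat.of ℤ (BalTensor ℤ R X N)
  map f := ModuleCat.ofHom (balTensorMap R f.hom LinearMap.id)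
  map_id _ := ModuleCat.hom_ext (balTensor_hom_ext fun _ _ => rfl)
  map_comp _ _ := ModuleCat.hom_ext (balTensor_hom_ext fun _ _ => rfl)

instance balTensorFunctor_additive (R : Type u) [Ring R] (N : Type u) [AddCommGroup N]
    [Module R N] : (balTensorFunctor R N).Additive where
  map_add {_ _ f g} := ModuleCat.hom_ext (balTensor_hom_ext fun x y =>
    congrArg Submodule.Quotient.mk (TensorProduct.add_tmul (f.hom x) (g.hom x) y))

/-- `Tor_i^R(U, N)` for a right `R`-module `U` and a left `R`-module `N`: the value at `U` of the
`i`th left derived functor of `- ⊗_R N`. -/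
def torR (R : Type u) [Ring R] (i : ℕ) (U : Type u) [AddCommGroup U] [Module Rᵐᵒᵖ U]
    (N : Type u) [AddCommGroup N] [Module R N] : ModuleCat.{u} ℤ :=
  ((balTensorFunctor R N).leftDerived i).obj (ModuleCat.of Rᵐᵒᵖ U)

/-! ### `(n, d)`-injective and `(n, d)`-flat modules -/

/-- The left `S`-module `M` is `(n, d)`-injective. -/
def IsNDInjective (S : Type u) [Ring S] (n : ℕ∞) (d : ℕ)
    (M : Type u) [AddCommGroup M] [Module S M] : Prop :=
  ∀ (U : Type u) [AddCommGroup U] [Module S U], IsFinitelyNPresented S n U →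
    Subsingleton (Abelian.Ext (ModuleCat.of S U) (ModuleCat.of S M) (d + 1))

/-- The left `R`-module `N` is `(n, d)`-flat. -/
def IsNDFlat (R : Type u) [Ring R] (n : ℕ∞) (d : ℕ)
    (N : Type u) [AddCommGroup N] [Module R N] : Prop :=
  ∀ (U : Type u) [AddCommGroup U] [Module Rᵐᵒᵖ U], IsFinitelyNPresented Rᵐᵒᵖ n U →
    Subsingleton (torR R (d + 1) U N)

/-! ### The left `R`-module `Hom_S(K, I)` and the relative classes -/

/-- `Hom_S(K, I)` for an `(S, R)`-bimodule `K` and a left `S`-module `I`. -/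
def BimodHom (S R K I : Type u) [Ring S] [Ring R] [AddCommGroup K] [Module S K]
    [Module Rᵐᵒᵖ K] [SMulCommClass S Rᵐᵒᵖ K]
    [AddCommGroup I] [Module S I] : Type u :=
  K →ₗ[S] I

instance BimodHom.addCommGroup (S R K I : Type u) [Ring S] [Ring R] [AddCommGroup K] [Module S K]
    [Module Rᵐᵒᵖ K] [SMulCommClass S Rᵐᵒᵖ K]
    [AddCommGroup I] [Module S I] : AddCommGroup (BimodHom S R K I) :=
  inferInstanceAs (AddCommGroup (K →ₗ[S] I))

/-- The left `R`-module structure `(r φ)(x) = φ(x r)`. -/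
instance BimodHom.module (S R K I : Type u) [Ring S] [Ring R] [AddCommGroup K] [Module S K]
    [Module Rᵐᵒᵖ K] [SMulCommClass S Rᵐᵒᵖ K]
    [AddCommGroup I] [Module S I] : Module R (BimodHom S R K I) where
  smul r φ := LinearMap.comp (φ : K →ₗ[S] I) (rightMul S R K r)
  one_smul φ := LinearMap.ext fun x =>
    congrArg (show K →ₗ[S] I from φ) (one_smul Rᵐᵒᵖ x)
  mul_smul r s φ := LinearMap.ext fun x =>
    congrArg (show K →ₗ[S] I from φ) (mul_smul (MulOpposite.op s) (MulOpposite.op r) x)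
  smul_zero _ := rfl
  smul_add _ _ _ := rfl
  add_smul r s φ := LinearMap.ext fun x =>
    (congrArg (show K →ₗ[S] I from φ) (add_smul (MulOpposite.op r) (MulOpposite.op s) x)).trans
      (map_add (show K →ₗ[S] I from φ) _ _)
  zero_smul φ := LinearMap.ext fun x =>
    (congrArg (show K →ₗ[S] I from φ) (zero_smul Rᵐᵒᵖ x)).trans (map_zero (show K →ₗ[S] I from φ))

/-- The left `R`-module `M` is `K`-`(n, d)`-injective: `M ≅ Hom_S(K, I)` for some
`(n, d)`-injective left `S`-module `I`. -/
def IsRelNDInjective (S R K : Type u) [Ring S] [Ring R] [AddCommGroup K] [Module S K]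
    [Module Rᵐᵒᵖ K] [SMulCommClass S Rᵐᵒᵖ K] (n : ℕ∞) (d : ℕ)
    (M : Type u) [AddCommGroup M] [Module R M] : Prop :=
  ∃ (I : Type u) (_ : AddCommGroup I) (_ : Module S I),
    IsNDInjective S n d I ∧ Nonempty (M ≃ₗ[R] BimodHom S R K I)

/-- The left `S`-module `N` is `K`-`(n, d)`-flat: `N ≅ K ⊗_R F` for some `(n, d)`-flat left
`R`-module `F`. -/
def IsRelNDFlat (S R K : Type u) [Ring S] [Ring R] [AddCommGroup K] [Module S K]
    [Module Rᵐᵒᵖ K] [SMulCommClass S Rᵐᵒᵖ K] (n : ℕ∞) (d : ℕ)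
    (N : Type u) [AddCommGroup N] [Module S N] : Prop :=
  ∃ (F : Type u) (_ : AddCommGroup F) (_ : Module R F),
    IsNDFlat R n d F ∧ Nonempty (N ≃ₗ[S] BalTensor S R K F)

/-! ### Purity -/

/-- The submodule `N` of the left `A`-module `M` is pure: `X ⊗_A N → X ⊗_A M` is injective for
every right `A`-module `X`. -/
def IsPureSubmodule {A : Type u} [Ring A] {M : Type u} [AddCommGroup M] [Module A M]
    (N : Submodule A M) : Prop :=
  ∀ (X : Type u) [AddCommGroup X] [Module Aᵐᵒᵖ X],
    Function.Injective (balTensorMap A (LinearMap.id : X →ₗ[Aᵐᵒᵖ] X) N.subtype)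

/-- The linear map `g` is a pure epimorphism: it is onto and its kernel is a pure submodule. -/
def IsPureEpi {A : Type u} [Ring A] {M Q : Type u} [AddCommGroup M] [Module A M]
    [AddCommGroup Q] [Module A Q] (g : M →ₗ[A] Q) : Prop :=
  Function.Surjective g ∧ IsPureSubmodule (LinearMap.ker g)

end

/-! The proof is a Foxby equivalence that respects purity. Write K for K_{d-1}, and consider the
unit M → Hom_S(K, K ⊗ M) (`unitMap`) and the counit K ⊗ Hom_S(K, I) → I (`counitMap`).

The counit is bijective for every (n,d)-injective I. Shifting from K back to C gives Ext^i_S(K, I) =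
Ext^{d+i}_S(C, I) = 0 for i ≥ 1. Apply Hom_{R^op}(-, K) to a resolution of K by finitely generated
free right R-modules. Since K has no self-extensions and S = Hom_{R^op}(K, K), this gives an exact
complex 0 → S → K^{m₀} → K^{m₁} → ⋯ whose cosyzygies are super finitely presented over S. Dimension
shifting along this complex shows that Hom_S(-, I) keeps its beginning exact. So I is the cokernel
of Hom_S(K, I)^{m₁} → Hom_S(K, I)^{m₀}, and this cokernel is K ⊗ Hom_S(K, I)
(`exists_coresolution`). For an (n,d)-flat F, the same argument with the two sides exchanged applies
to the character module F⁺. Because Hom(K, F⁺) = (K ⊗ F)⁺, it shows that the unit of F is bijective.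

Consequently M is K-(n,d)-injective exactly when its unit is bijective and K ⊗ M is (n,d)-injective.
Dually, M is K-(n,d)-flat exactly when its counit is bijective and Hom_S(K, M) is (n,d)-flat. These
intrinsic conditions pass along a pure exact sequence 0 → N → M → Q → 0. Purity means that finite
linear systems solvable in M are solvable in N, so maps from finitely presented modules lift along M
→ Q. This survives K ⊗ -, and K is finitely presented on both sides.

The bound n > d + 1 makes the dth syzygy V of a finitely n-presented module finitely presented, with
finitely presented first syzygy. Ext^{d+1} and Tor_{d+1} then become Ext^1 and Tor_1 of V, which
only involve finitely presented modules (`IsFinitelyNPresented.exists_syzygy`). -/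

noncomputable section

/-! ### Elementary properties of the tensor product over a noncommutative ring -/

section BalTensor

variable (T T' : Type*) (R : Type u) [Ring T] [Ring T'] [Ring R]
  {X X' N N' Y : Type u}
  [AddCommGroup X] [Module T X] [Module Rᵐᵒᵖ X] [SMulCommClass T Rᵐᵒᵖ X]
  [AddCommGroup X'] [Module T' X'] [Module Rᵐᵒᵖ X'] [SMulCommClass T' Rᵐᵒᵖ X']
  [AddCommGroup N] [Module R N] [AddCommGroup N'] [Module R N']

/-- The element `x ⊗ y` of `X ⊗_R N`. -/
def balTmul (x : X) (y : N) : BalTensor T R X N := Submodule.Quotient.mk (x ⊗ₜ[ℤ] y)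

theorem balTmul_add (x : X) (y y' : N) :
    balTmul T R x (y + y') = balTmul T R x y + balTmul T R x y' := by
  simp [balTmul, TensorProduct.tmul_add]

theorem add_balTmul (x x' : X) (y : N) :
    balTmul T R (x + x') y = balTmul T R x y + balTmul T R x' y := by
  simp [balTmul, TensorProduct.add_tmul]

theorem balTmul_zero (x : X) : balTmul T R x (0 : N) = 0 := by
  simp [balTmul]

theorem zero_balTmul (y : N) : balTmul T R (0 : X) y = 0 := by
  simp [balTmul]

theorem balTmul_sum {ι : Type*} (s : Finset ι) (x : X) (y : ι → N) :
    balTmul T R x (∑ i ∈ s, y i) = ∑ i ∈ s, balTmul T R x (y i) :=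
  map_sum (AddMonoidHom.mk' (fun y : N => balTmul T R x y) (balTmul_add T R x)) y s

theorem sum_balTmul {ι : Type*} (s : Finset ι) (x : ι → X) (y : N) :
    balTmul T R (∑ i ∈ s, x i) y = ∑ i ∈ s, balTmul T R (x i) y :=
  map_sum (AddMonoidHom.mk' (fun x : X => balTmul T R x y)
    (fun x x' => add_balTmul T R x x' y)) x s

theorem op_smul_balTmul (r : R) (x : X) (y : N) :
    balTmul T R (MulOpposite.op r • x) y = balTmul T R x (r • y) := by
  rw [← sub_eq_zero]
  exact (Submodule.Quotient.mk_eq_zero _).2 (Submodule.subset_span ⟨x, r, y, rfl⟩)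

theorem smul_balTmul (t : T) (x : X) (y : N) :
    t • balTmul T R x y = balTmul T R (t • x) y := rfl

variable {T R} in
theorem balTensor_induction {p : BalTensor T R X N → Prop} (z : BalTensor T R X N)
    (tmul : ∀ x y, p (balTmul T R x y)) (zero : p 0)
    (add : ∀ a b, p a → p b → p (a + b)) : p z := by
  obtain ⟨z, rfl⟩ := Submodule.Quotient.mk_surjective _ z
  induction z with
  | zero => exact zero
  | tmul x y => exact tmul x y
  | add a b ha hb => exact add _ _ ha hb

variable {T R} in
theorem balTensor_addHom_ext [AddCommGroup Y] {f g : BalTensor T R X N →+ Y}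
    (h : ∀ x y, f (balTmul T R x y) = g (balTmul T R x y)) : f = g := by
  ext z
  induction z using balTensor_induction with
  | tmul x y => exact h x y
  | zero => simp
  | add a b ha hb => simp [ha, hb]

/-- The universal property of `X ⊗_R N`. -/
def balLift {Y : Type*} [AddCommGroup Y] (f : X →+ N →+ Y)
    (h : ∀ x (r : R) y, f (MulOpposite.op r • x) y = f x (r • y)) : BalTensor T R X N →+ Y :=
  QuotientAddGroup.lift (Submodule.span T (balancedRel R X N)).toAddSubgroup
    (TensorProduct.liftAddHom f fun n x y => by simp) (by
      rw [span_balancedRel, AddSubgroup.closure_le]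
      rintro _ ⟨x, r, y, rfl⟩
      simp [h])

@[simp]
theorem balLift_tmul {Y : Type*} [AddCommGroup Y] (f : X →+ N →+ Y)
    (h : ∀ x (r : R) y, f (MulOpposite.op r • x) y = f x (r • y)) (x : X) (y : N) :
    balLift T R f h (balTmul T R x y) = f x y := rfl

/-- The additive map `f ⊗ g`, between tensor products with possibly different left actions. -/
def balMap (f : X →ₗ[Rᵐᵒᵖ] X') (g : N →ₗ[R] N') :
    BalTensor T R X N →+ BalTensor T' R X' N' :=
  balLift T R
    (AddMonoidHom.mk' (fun x => AddMonoidHom.mk' (fun y => balTmul T' R (f x) (g y))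
      (by simp [balTmul_add])) (by intros; ext; simp [add_balTmul]))
    (by simp [op_smul_balTmul])

@[simp]
theorem balMap_tmul (f : X →ₗ[Rᵐᵒᵖ] X') (g : N →ₗ[R] N') (x : X) (y : N) :
    balMap T T' R f g (balTmul T R x y) = balTmul T' R (f x) (g y) := rfl

theorem balTensorMap_eq_balMap {X X' N N' : Type u} [AddCommGroup X] [AddCommGroup X']
    [Module Rᵐᵒᵖ X] [Module Rᵐᵒᵖ X'] [AddCommGroup N] [Module R N] [AddCommGroup N'] [Module R N']
    (f : X →ₗ[Rᵐᵒᵖ] X') (g : N →ₗ[R] N') :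
    (balTensorMap R f g).toAddMonoidHom = balMap ℤ ℤ R f g :=
  balTensor_addHom_ext fun _ _ => rfl

end BalTensor

/-! ### Functoriality and right exactness of the tensor product. -/

section Functoriality

variable (T T' T'' : Type*) (R : Type u) [Ring T] [Ring T'] [Ring T''] [Ring R]
  {X X' X'' N N' N'' Y : Type u}
  [AddCommGroup X] [Module T X] [Module Rᵐᵒᵖ X] [SMulCommClass T Rᵐᵒᵖ X]
  [AddCommGroup X'] [Module T' X'] [Module Rᵐᵒᵖ X'] [SMulCommClass T' Rᵐᵒᵖ X']
  [AddCommGroup X''] [Module T'' X''] [Module Rᵐᵒᵖ X''] [SMulCommClass T'' Rᵐᵒᵖ X'']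
  [AddCommGroup N] [Module R N] [AddCommGroup N'] [Module R N'] [AddCommGroup N''] [Module R N'']

theorem balMap_balMap (f : X →ₗ[Rᵐᵒᵖ] X') (g : N →ₗ[R] N') (f' : X' →ₗ[Rᵐᵒᵖ] X'')
    (g' : N' →ₗ[R] N'') (z : BalTensor T R X N) :
    balMap T' T'' R f' g' (balMap T T' R f g z) = balMap T T'' R (f' ∘ₗ f) (g' ∘ₗ g) z :=
  DFunLike.congr_fun (balTensor_addHom_ext (f := (balMap T' T'' R f' g').comp (balMap T T' R f g))
    (g := balMap T T'' R (f' ∘ₗ f) (g' ∘ₗ g)) fun _ _ => rfl) z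

theorem balMap_id (z : BalTensor T R X N) :
    balMap T T R (LinearMap.id : X →ₗ[Rᵐᵒᵖ] X) (LinearMap.id : N →ₗ[R] N) z = z :=
  DFunLike.congr_fun (balTensor_addHom_ext (f := balMap T T R LinearMap.id LinearMap.id)
    (g := AddMonoidHom.id (BalTensor T R X N)) fun _ _ => rfl) z

variable {T T' R} in
theorem balMap_zero_left (g : N →ₗ[R] N') (z : BalTensor T R X N) :
    balMap T T' R (0 : X →ₗ[Rᵐᵒᵖ] X') g z = 0 :=
  DFunLike.congr_fun (balTensor_addHom_ext (f := balMap T T' R (0 : X →ₗ[Rᵐᵒᵖ] X') g)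
    (g := 0) fun x y => by simp [zero_balTmul]) z

variable {T T' R} in
theorem balMap_zero_right (f : X →ₗ[Rᵐᵒᵖ] X') (z : BalTensor T R X N) :
    balMap T T' R f (0 : N →ₗ[R] N') z = 0 :=
  DFunLike.congr_fun (balTensor_addHom_ext (f := balMap T T' R f (0 : N →ₗ[R] N'))
    (g := 0) fun x y => by simp [balTmul_zero]) z

theorem balMap_surjective {f : X →ₗ[Rᵐᵒᵖ] X'} {g : N →ₗ[R] N'} (hf : Function.Surjective f)
    (hg : Function.Surjective g) : Function.Surjective (balMap T T' R f g) := by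
  intro z
  induction z using balTensor_induction with
  | tmul x y =>
    obtain ⟨x, rfl⟩ := hf x
    obtain ⟨y, rfl⟩ := hg y
    exact ⟨balTmul T R x y, rfl⟩
  | zero => exact ⟨0, map_zero _⟩
  | add a b ha hb =>
    obtain ⟨a, rfl⟩ := ha
    obtain ⟨b, rfl⟩ := hb
    exact ⟨a + b, map_add _ _ _⟩

/-- Right exactness of `- ⊗_R N`. -/
theorem balMap_exact_left {f : X →ₗ[Rᵐᵒᵖ] X'} {g : X' →ₗ[Rᵐᵒᵖ] X''} (h : Function.Exact f g)
    (hg : Function.Surjective g) :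
    Function.Exact (balMap T T' R f (LinearMap.id : N →ₗ[R] N))
      (balMap T' T'' R g (LinearMap.id : N →ₗ[R] N)) := by
  set H := (balMap T T' R f (LinearMap.id : N →ₗ[R] N)).range with hH
  have key : ∀ x' y' (n : N), g x' = g y' →
      (QuotientAddGroup.mk (balTmul T' R x' n) : _ ⧸ H) =
        QuotientAddGroup.mk (balTmul T' R y' n) := by
    intro x' y' n hxy
    obtain ⟨x, hx⟩ := (h (y' - x')).1 (by simp [hxy])
    rw [QuotientAddGroup.eq]
    refine ⟨balTmul T R x n, ?_⟩
    have : y' = x' + f x := by rw [hx]; abel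
    simp [this, add_balTmul]
  let s := Function.surjInv hg
  have hs : ∀ x, g (s x) = x := Function.surjInv_eq hg
  -- An inverse of the map induced on the cokernel, built from a set-theoretic section of `g`; `key`
  -- makes it additive and balanced although the section is neither.
  let inv : BalTensor T'' R X'' N →+ (BalTensor T' R X' N ⧸ H) :=
    balLift T'' R (AddMonoidHom.mk' (fun x => AddMonoidHom.mk'
      (fun n => (QuotientAddGroup.mk (balTmul T' R (s x) n) : _ ⧸ H))
      (by intro a b; rw [balTmul_add]; rfl))
      (by
        intro a b
        ext n
        refine (key _ (s a + s b) n (by simp [hs])).trans ?_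
        rw [add_balTmul]; rfl))
      (by
        intro x r n
        refine (key _ (MulOpposite.op r • s x) n (by simp [hs])).trans ?_
        rw [op_smul_balTmul]; rfl)
  have hinv : ∀ z, inv (balMap T' T'' R g LinearMap.id z) = QuotientAddGroup.mk z := by
    intro z
    refine DFunLike.congr_fun (balTensor_addHom_ext
      (f := inv.comp (balMap T' T'' R g LinearMap.id)) (g := QuotientAddGroup.mk' H) ?_) z
    intro x n
    exact key _ _ n (hs _)
  intro z
  constructor
  · intro hz
    have := hinv z
    rw [hz, map_zero] at this
    exact (QuotientAddGroup.eq_zero_iff z).1 this.symm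
  · rintro ⟨w, rfl⟩
    rw [balMap_balMap, h.linearMap_comp_eq_zero, balMap_zero_left]

/-- Right exactness of `X ⊗_R -`. -/
theorem balMap_exact_right {f : N →ₗ[R] N'} {g : N' →ₗ[R] N''} (h : Function.Exact f g)
    (hg : Function.Surjective g) [Module T' X] [SMulCommClass T' Rᵐᵒᵖ X] [Module T'' X]
    [SMulCommClass T'' Rᵐᵒᵖ X] :
    Function.Exact (balMap T T' R (LinearMap.id : X →ₗ[Rᵐᵒᵖ] X) f)
      (balMap T' T'' R (LinearMap.id : X →ₗ[Rᵐᵒᵖ] X) g) := by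
  set H := (balMap T T' R (LinearMap.id : X →ₗ[Rᵐᵒᵖ] X) f).range with hH
  have key : ∀ n n' (x : X), g n = g n' →
      (QuotientAddGroup.mk (balTmul T' R x n) : _ ⧸ H) =
        QuotientAddGroup.mk (balTmul T' R x n') := by
    intro n n' x hxy
    obtain ⟨m, hm⟩ := (h (n' - n)).1 (by simp [hxy])
    rw [QuotientAddGroup.eq]
    refine ⟨balTmul T R x m, ?_⟩
    have : n' = n + f m := by rw [hm]; abel
    simp [this, balTmul_add]
  let s := Function.surjInv hg
  have hs : ∀ x, g (s x) = x := Function.surjInv_eq hg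
  let inv : BalTensor T'' R X N'' →+ (BalTensor T' R X N' ⧸ H) :=
    balLift T'' R (AddMonoidHom.mk' (fun x => AddMonoidHom.mk'
      (fun n => (QuotientAddGroup.mk (balTmul T' R x (s n)) : _ ⧸ H))
      (by
        intro a b
        refine (key _ (s a + s b) x (by simp [hs])).trans ?_
        rw [balTmul_add]; rfl))
      (by
        intro a b
        ext n
        simp only [AddMonoidHom.mk'_apply, add_balTmul]; rfl))
      (by
        intro x r n
        simp only [AddMonoidHom.mk'_apply, op_smul_balTmul]
        exact key _ _ x (by simp [hs]))
  have hinv : ∀ z, inv (balMap T' T'' R LinearMap.id g z) = QuotientAddGroup.mk z := by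
    intro z
    refine DFunLike.congr_fun (balTensor_addHom_ext
      (f := inv.comp (balMap T' T'' R LinearMap.id g)) (g := QuotientAddGroup.mk' H) ?_) z
    intro x n
    exact key _ _ x (hs _)
  intro z
  constructor
  · intro hz
    have := hinv z
    rw [hz, map_zero] at this
    exact (QuotientAddGroup.eq_zero_iff z).1 this.symm
  · rintro ⟨w, rfl⟩
    rw [balMap_balMap, h.linearMap_comp_eq_zero, balMap_zero_right]

/-- Purity of `N ⊆ M` at `X`, for any left action on `X`. -/
theorem IsPureSubmodule.injective_balMap {M : Type u} [AddCommGroup M] [Module R M]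
    {N : Submodule R M} (hN : IsPureSubmodule N) [Module T' X] [SMulCommClass T' Rᵐᵒᵖ X] :
    Function.Injective (balMap T T' R (LinearMap.id : X →ₗ[Rᵐᵒᵖ] X) N.subtype) := by
  rw [injective_iff_map_eq_zero]
  intro z hz
  -- The left actions do not affect the underlying group, so `balMap` of identities passes to the
  -- version over ℤ and back.
  have h1 := (injective_iff_map_eq_zero (balMap ℤ ℤ R (LinearMap.id : X →ₗ[Rᵐᵒᵖ] X) N.subtype)).1
    (by rw [← balTensorMap_eq_balMap]; exact hN X)
  have h2 := h1 (balMap T ℤ R LinearMap.id LinearMap.id z) (by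
    rw [balMap_balMap]
    have := congrArg (balMap T' ℤ R LinearMap.id LinearMap.id) hz
    rw [balMap_balMap, map_zero] at this
    exact this)
  have h3 := congrArg (balMap ℤ T R LinearMap.id LinearMap.id) h2
  rw [balMap_balMap, map_zero] at h3
  exact (balMap_id T R z).symm.trans h3

theorem balMap_bijective_of_equiv (e : X ≃ₗ[Rᵐᵒᵖ] X') (e' : N ≃ₗ[R] N') :
    Function.Bijective (balMap T T' R e.toLinearMap e'.toLinearMap) := by
  refine Function.bijective_iff_has_inverse.2
    ⟨balMap T' T R e.symm.toLinearMap e'.symm.toLinearMap, fun z => ?_, fun z => ?_⟩ <;>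
  · rw [balMap_balMap]
    simp [balMap_id]

end Functoriality

/-! ### The character module of a left module as a right module -/

/-- The character module of a left `R`-module, a right `R`-module. -/
def RightDual (F : Type u) [AddCommGroup F] : Type u := F →+ AddCircle (1 : ℚ)

section RightDual

variable (R : Type u) [Ring R] (F : Type u) [AddCommGroup F] [Module R F]

instance : AddCommGroup (RightDual F) := inferInstanceAs (AddCommGroup (F →+ AddCircle (1 : ℚ)))

/-- The value of a character. -/
def RightDual.eval {F : Type u} [AddCommGroup F] (c : RightDual F) : F →+ AddCircle (1 : ℚ) := c

instance : Module Rᵐᵒᵖ (RightDual F) where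
  smul r c := c.eval.comp (DistribSMul.toAddMonoidHom F r.unop)
  one_smul c := AddMonoidHom.ext fun x => congrArg c.eval (one_smul R x)
  mul_smul r s c := AddMonoidHom.ext fun x => congrArg c.eval (mul_smul s.unop r.unop x)
  smul_zero _ := rfl
  smul_add _ _ _ := rfl
  add_smul r s c := AddMonoidHom.ext fun x =>
    (congrArg c.eval (add_smul r.unop s.unop x)).trans (map_add c.eval _ _)
  zero_smul c := AddMonoidHom.ext fun x =>
    (congrArg c.eval (zero_smul R x)).trans (map_zero c.eval)

variable {R F}

@[simp]
theorem RightDual.smul_eval (r : Rᵐᵒᵖ) (c : RightDual F) (x : F) :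
    (r • c).eval x = c.eval (r.unop • x) := rfl

@[simp]
theorem RightDual.add_eval (c c' : RightDual F) : (c + c').eval = c.eval + c'.eval := rfl

/-- Evaluation at `x` as an additive map. -/
def RightDual.evalAt (x : F) : RightDual F →+ AddCircle (1 : ℚ) :=
  AddMonoidHom.mk' (fun c => c.eval x) fun _ _ => rfl

theorem RightDual.sum_eval {ι : Type*} (s : Finset ι) (c : ι → RightDual F) (x : F) :
    (∑ i ∈ s, c i).eval x = ∑ i ∈ s, (c i).eval x :=
  map_sum (RightDual.evalAt x) c s

variable (T : Type*) [Ring T] {X : Type u} [AddCommGroup X] [Module T X] [Module Rᵐᵒᵖ X]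
  [SMulCommClass T Rᵐᵒᵖ X]

variable (R F) in
/-- The linear map `X → F⁺` attached to a character of `X ⊗_R F`. -/
def toRightDual (χ : BalTensor T R X F →+ AddCircle (1 : ℚ)) : X →ₗ[Rᵐᵒᵖ] RightDual F where
  toFun x := AddMonoidHom.mk' (fun y => χ (balTmul T R x y)) (by simp [balTmul_add])
  map_add' x x' := AddMonoidHom.ext fun y => by simp [add_balTmul]; rfl
  map_smul' r x := AddMonoidHom.ext fun y => congrArg χ (op_smul_balTmul T R r.unop x y)

/-- The character of `X ⊗_R F` attached to a linear map `X → F⁺`. -/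
def ofRightDual (φ : X →ₗ[Rᵐᵒᵖ] RightDual F) : BalTensor T R X F →+ AddCircle (1 : ℚ) :=
  balLift T R (AddMonoidHom.mk' (fun x => (φ x).eval) (by simp)) (by simp)

@[simp]
theorem ofRightDual_tmul (φ : X →ₗ[Rᵐᵒᵖ] RightDual F) (x : X) (y : F) :
    ofRightDual T φ (balTmul T R x y) = (φ x).eval y := rfl

end RightDual

/-- Characters separate the elements outside a subgroup from the subgroup. -/
theorem exists_character_of_notMem {A : Type u} [AddCommGroup A] (H : AddSubgroup A) {x : A}
    (hx : x ∉ H) : ∃ χ : A →+ AddCircle (1 : ℚ), (∀ h ∈ H, χ h = 0) ∧ χ x ≠ 0 := by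
  obtain ⟨c, hc⟩ := CharacterModule.exists_character_apply_ne_zero_of_ne_zero
    (a := (QuotientAddGroup.mk x : A ⧸ H)) (by rwa [Ne, QuotientAddGroup.eq_zero_iff])
  refine ⟨AddMonoidHom.comp c (QuotientAddGroup.mk' H), fun h hh => ?_, hc⟩
  have : (QuotientAddGroup.mk' H h) = 0 := (QuotientAddGroup.eq_zero_iff h).2 hh
  exact (congrArg c this).trans (map_zero c)

theorem eq_zero_of_forall_character {A : Type u} [AddCommGroup A] {x : A}
    (h : ∀ χ : A →+ AddCircle (1 : ℚ), χ x = 0) : x = 0 := by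
  by_contra hx
  obtain ⟨χ, -, hχ⟩ := exists_character_of_notMem ⊥ (x := x) hx
  exact hχ (h χ)

/-- Characters of a subgroup extend. -/
theorem exists_character_extension {A B : Type u} [AddCommGroup A] [AddCommGroup B] (f : A →+ B)
    (hf : Function.Injective f) (χ : A →+ AddCircle (1 : ℚ)) :
    ∃ χ' : B →+ AddCircle (1 : ℚ), ∀ a, χ' (f a) = χ a := by
  obtain ⟨c, hc⟩ := CharacterModule.dual_surjective_of_injective f.toIntLinearMap hf χ
  exact ⟨c, fun a => DFunLike.congr_fun hc a⟩

/-! ### Dimension shifting for `Tor` -/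

section Splice

open Limits

variable {C : Type*} [Category* C] [Abelian C] {W G V : C} (P : ProjectiveResolution W)

/-- The augmentation of a projective resolution, as a morphism to the resolved object. -/
def CategoryTheory.ProjectiveResolution.aug : P.complex.X 0 ⟶ W := P.π.f 0

instance : Epi P.aug := inferInstanceAs (Epi (P.π.f 0))

theorem CategoryTheory.ProjectiveResolution.d_aug : P.complex.d 1 0 ≫ P.aug = 0 :=
  P.complex_d_comp_π_f_zero

theorem CategoryTheory.ProjectiveResolution.exact_aug :
    (ShortComplex.mk _ _ P.d_aug).Exact := P.exact₀

theorem CategoryTheory.ProjectiveResolution.exact_d_aug_comp (i : W ⟶ G) [Mono i] :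
    (ShortComplex.mk (P.complex.d 1 0) (P.aug ≫ i)
      (by rw [← Category.assoc, P.d_aug, zero_comp])).Exact := by
  let α : ShortComplex.mk _ _ P.d_aug ⟶ ShortComplex.mk (P.complex.d 1 0) (P.aug ≫ i)
      (by rw [← Category.assoc, P.d_aug, zero_comp]) :=
    { τ₁ := 𝟙 _, τ₂ := 𝟙 _, τ₃ := i }
  exact (ShortComplex.exact_iff_of_epi_of_isIso_of_mono α).1 P.exact_aug

/-- The complex of a spliced resolution. -/
def CategoryTheory.ProjectiveResolution.spliceComplex (i : W ⟶ G) : ChainComplex C ℕ :=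
  ChainComplex.augment P.complex (P.aug ≫ i) (by rw [← Category.assoc, P.d_aug, zero_comp])

theorem CategoryTheory.ProjectiveResolution.spliceComplex_exactAt_succ (i : W ⟶ G) [Mono i]
    (n : ℕ) : (P.spliceComplex i).ExactAt (n + 1) := by
  rw [HomologicalComplex.exactAt_iff' _ (n + 1 + 1) (n + 1) n (by simp) (by simp)]
  cases n with
  | zero => exact P.exact_d_aug_comp i
  | succ n => exact P.exact_succ n

theorem CategoryTheory.ProjectiveResolution.splice_exact (i : W ⟶ G) (p : G ⟶ V)
    (w : i ≫ p = 0) (ex : (ShortComplex.mk i p w).Exact) :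
    (ShortComplex.mk (P.aug ≫ i) p (by rw [Category.assoc, w, comp_zero])).Exact := by
  let α : ShortComplex.mk (P.aug ≫ i) p (by rw [Category.assoc, w, comp_zero]) ⟶
      ShortComplex.mk i p w :=
    { τ₁ := P.aug, τ₂ := 𝟙 _, τ₃ := 𝟙 _ }
  exact (ShortComplex.exact_iff_of_epi_of_isIso_of_mono α).2 ex

/-- Splicing a projective resolution of `W` with a short exact sequence `0 → W → G → V → 0` with
`G` projective gives a projective resolution of `V`. -/
def CategoryTheory.ProjectiveResolution.splice (i : W ⟶ G) (p : G ⟶ V) [Mono i] [Epi p]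
    (w : i ≫ p = 0) (ex : (ShortComplex.mk i p w).Exact) [Projective G] :
    ProjectiveResolution V where
  complex := P.spliceComplex i
  projective n := by
    cases n with
    | zero => exact inferInstanceAs (Projective G)
    | succ n => exact inferInstanceAs (Projective (P.complex.X n))
  π := (ChainComplex.toSingle₀Equiv _ _).symm ⟨p, by
    change (P.aug ≫ i) ≫ p = 0
    rw [Category.assoc, w, comp_zero]⟩
  quasiIso := ⟨fun n => by
    cases n
    · rw [ChainComplex.quasiIsoAt₀_iff, ShortComplex.quasiIso_iff_of_zeros']
      · refine (ShortComplex.exact_and_epi_g_iff_of_iso ?_).2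
          ⟨P.splice_exact i p w ex, ‹Epi p›⟩
        exact ShortComplex.isoMk (Iso.refl _) (Iso.refl _) (Iso.refl _)
          ((Category.id_comp (P.aug ≫ i)).trans (Category.comp_id (P.aug ≫ i)).symm)
          ((Category.id_comp p).trans
            ((ChainComplex.toSingle₀Equiv_symm_apply_f_zero (C := P.spliceComplex i) p _).symm.trans
              (Category.comp_id _).symm))
      all_goals rfl
    · rw [quasiIsoAt_iff_exactAt']
      · apply P.spliceComplex_exactAt_succ
      · apply ChainComplex.exactAt_succ_single_obj⟩

end Splice

section Tor

variable {R : Type u} [Ring R] {G V : Type u} [AddCommGroup G] [Module Rᵐᵒᵖ G]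
  [AddCommGroup V] [Module Rᵐᵒᵖ V] (N : Type u) [AddCommGroup N] [Module R N]

open Limits

/-- Exactness of `c ⊗_R N` in degree `i + 1`. -/
def TensorExactAt (c : ChainComplex (ModuleCat.{u} Rᵐᵒᵖ) ℕ) (i : ℕ) : Prop :=
  Function.Exact (balMap ℤ ℤ R (c.d (i + 2) (i + 1)).hom (LinearMap.id : N →ₗ[R] N))
    (balMap ℤ ℤ R (c.d (i + 1) i).hom (LinearMap.id : N →ₗ[R] N))

theorem tensorExactAt_spliceComplex {W G : ModuleCat.{u} Rᵐᵒᵖ} (P : ProjectiveResolution W)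
    (i : W ⟶ G) (n : ℕ) :
    TensorExactAt N (P.spliceComplex i) (n + 1) ↔ TensorExactAt N P.complex n := Iff.rfl

theorem tensorExactAt_spliceComplex_zero {W G : ModuleCat.{u} Rᵐᵒᵖ} (P : ProjectiveResolution W)
    (i : W ⟶ G) :
    TensorExactAt N (P.spliceComplex i) 0 ↔
      Function.Exact (balMap ℤ ℤ R (P.complex.d 1 0).hom (LinearMap.id : N →ₗ[R] N))
        (balMap ℤ ℤ R (P.aug ≫ i).hom LinearMap.id) := Iff.rfl

theorem subsingleton_torR_iff {U : Type u} [AddCommGroup U] [Module Rᵐᵒᵖ U]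
    (P : ProjectiveResolution (ModuleCat.of Rᵐᵒᵖ U)) (i : ℕ) :
    Subsingleton (torR R (i + 1) U N) ↔ TensorExactAt N P.complex i := by
  rw [torR, ← ModuleCat.isZero_iff_subsingleton,
    (P.isoLeftDerivedObj (balTensorFunctor R N) (i + 1)).isZero_iff]
  refine (HomologicalComplex.exactAt_iff_isZero_homology _ _).symm.trans ?_
  rw [HomologicalComplex.exactAt_iff' _ (i + 1 + 1) (i + 1) i (by simp) (by simp),
    ShortComplex.ShortExact.moduleCat_exact_iff_function_exact]
  rw [TensorExactAt, ← balTensorMap_eq_balMap, ← balTensorMap_eq_balMap]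
  exact Iff.rfl

variable (π : G →ₗ[Rᵐᵒᵖ] V) (hπ : Function.Surjective π) [Module.Projective Rᵐᵒᵖ G]

-- Derived functors can be computed from any projective resolution. The equality of complexes makes
-- the differentials of the resolution of `V` those of `P` moved up by one, with the composite
-- through `ker π` at the bottom.
include hπ in
theorem torR_shift_aux (P : ProjectiveResolution (ModuleCat.of Rᵐᵒᵖ (LinearMap.ker π))) :
    ∃ Q : ProjectiveResolution (ModuleCat.of Rᵐᵒᵖ V),
      Q.complex = P.spliceComplex (ModuleCat.ofHom (LinearMap.ker π).subtype) := by
  have : Projective (ModuleCat.of Rᵐᵒᵖ G) := inferInstance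
  have : Mono (ModuleCat.ofHom (LinearMap.ker π).subtype) :=
    (ModuleCat.mono_iff_injective _).2 (Submodule.subtype_injective _)
  have : Epi (ModuleCat.ofHom π) := (ModuleCat.epi_iff_surjective _).2 hπ
  have w : ModuleCat.ofHom (LinearMap.ker π).subtype ≫ ModuleCat.ofHom π = 0 := by
    ext x
    exact x.2
  refine ⟨P.splice (ModuleCat.ofHom (LinearMap.ker π).subtype) (ModuleCat.ofHom π) w ?_, rfl⟩
  rw [ShortComplex.ShortExact.moduleCat_exact_iff_function_exact]
  exact LinearMap.exact_subtype_ker_map π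

include hπ in
/-- Dimension shifting: `Tor_{i+2}(V, N) = Tor_{i+1}(ker π, N)`. -/
theorem subsingleton_torR_succ_iff (i : ℕ) :
    Subsingleton (torR R (i + 2) V N) ↔ Subsingleton (torR R (i + 1) (LinearMap.ker π) N) := by
  obtain ⟨P⟩ : Nonempty (ProjectiveResolution (ModuleCat.of Rᵐᵒᵖ (LinearMap.ker π))) :=
    ⟨ProjectiveResolution.of _⟩
  obtain ⟨Q, hQ⟩ := torR_shift_aux π hπ P
  rw [subsingleton_torR_iff N Q, subsingleton_torR_iff N P, hQ, tensorExactAt_spliceComplex]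

include hπ in
/-- `Tor_1(V, N) = 0` if and only if `ker π ⊗ N → G ⊗ N` is injective. -/
theorem subsingleton_torR_one_iff :
    Subsingleton (torR R 1 V N) ↔ Function.Injective
      (balMap ℤ ℤ R (LinearMap.ker π).subtype (LinearMap.id : N →ₗ[R] N)) := by
  obtain ⟨P⟩ : Nonempty (ProjectiveResolution (ModuleCat.of Rᵐᵒᵖ (LinearMap.ker π))) :=
    ⟨ProjectiveResolution.of _⟩
  obtain ⟨Q, hQ⟩ := torR_shift_aux π hπ P
  rw [subsingleton_torR_iff N Q, hQ, tensorExactAt_spliceComplex_zero]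
  have hs : Function.Surjective P.aug.hom := (ModuleCat.epi_iff_surjective _).1 inferInstance
  have ex : Function.Exact (P.complex.d 1 0).hom P.aug.hom :=
    (ShortComplex.ShortExact.moduleCat_exact_iff_function_exact _).1 P.exact_aug
  -- The cokernel of P₁ ⊗ N → P₀ ⊗ N is ker π ⊗ N, so exactness at P₀ ⊗ N says exactly that ker π ⊗
  -- N → G ⊗ N is injective.
  have ex' := balMap_exact_left ℤ ℤ ℤ R (N := N) ex hs
  rw [ModuleCat.hom_comp, ModuleCat.hom_ofHom]
  have comp : ∀ z, balMap ℤ ℤ R ((LinearMap.ker π).subtype ∘ₗ P.aug.hom)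
      (LinearMap.id : N →ₗ[R] N) z = balMap ℤ ℤ R (LinearMap.ker π).subtype
        (LinearMap.id : N →ₗ[R] N) (balMap ℤ ℤ R P.aug.hom LinearMap.id z) := fun z => by
    rw [balMap_balMap, LinearMap.id_comp]
  constructor
  · intro h
    rw [injective_iff_map_eq_zero]
    intro z hz
    obtain ⟨z, rfl⟩ := balMap_surjective ℤ ℤ R (g := (LinearMap.id : N →ₗ[R] N)) hs
      Function.surjective_id z
    rw [← comp] at hz
    exact (ex' z).2 ((h z).1 hz)
  · intro h z
    rw [comp, map_eq_zero_iff _ h]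
    exact ex' z

end Tor

/-! ### Vanishing of `Ext` -/

section Ext

variable (A : Type u) [Ring A]

/-- `Ext_A^i(X, Y) = 0`. -/
def ExtVanishes (i : ℕ) (X Y : Type u) [AddCommGroup X] [Module A X] [AddCommGroup Y]
    [Module A Y] : Prop :=
  Subsingleton (Abelian.Ext (ModuleCat.of A X) (ModuleCat.of A Y) i)

variable {A} {X Y Z I J : Type u} [AddCommGroup X] [Module A X] [AddCommGroup Y] [Module A Y]
  [AddCommGroup Z] [Module A Z] [AddCommGroup I] [Module A I] [AddCommGroup J] [Module A J]

open Abelian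

theorem ExtVanishes.congr_right {i : ℕ} (h : ExtVanishes A i X I) (e : I ≃ₗ[A] J) :
    ExtVanishes A i X J := by
  unfold ExtVanishes at h
  refine ⟨fun a b => ?_⟩
  have key : ∀ a : Ext (ModuleCat.of A X) (ModuleCat.of A J) i,
      (a.comp (Ext.mk₀ e.toModuleIso.inv) (add_zero i)).comp (Ext.mk₀ e.toModuleIso.hom)
        (add_zero i) = a := fun a => by
    rw [Ext.comp_assoc_of_second_deg_zero, Ext.mk₀_comp_mk₀, Iso.inv_hom_id, Ext.comp_mk₀_id]
  rw [← key a, ← key b, Subsingleton.elim (a.comp _ _) (b.comp _ _)]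

theorem ExtVanishes.congr_left {i : ℕ} (h : ExtVanishes A i X I) (e : X ≃ₗ[A] Y) :
    ExtVanishes A i Y I := by
  unfold ExtVanishes at h
  refine ⟨fun a b => ?_⟩
  have key : ∀ a : Ext (ModuleCat.of A Y) (ModuleCat.of A I) i,
      (Ext.mk₀ e.toModuleIso.inv).comp ((Ext.mk₀ e.toModuleIso.hom).comp a (zero_add i))
        (zero_add i) = a := fun a => by
    rw [Ext.mk₀_comp_mk₀_assoc, Iso.inv_hom_id, Ext.mk₀_id_comp]
  rw [← key a, ← key b, Subsingleton.elim ((Ext.mk₀ e.toModuleIso.hom).comp a _)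
    ((Ext.mk₀ e.toModuleIso.hom).comp b _)]

theorem ExtVanishes.of_projective [Module.Projective A X] (i : ℕ) : ExtVanishes A (i + 1) X I :=
  Ext.subsingleton_of_projective _ _ i

theorem ExtVanishes.of_subsingleton [Subsingleton X] (i : ℕ) : ExtVanishes A i X I := by
  have hX : Limits.IsZero (ModuleCat.of A X) := ModuleCat.isZero_of_subsingleton _
  refine ⟨fun a b => ?_⟩
  rw [← Ext.mk₀_id_comp a, ← Ext.mk₀_id_comp b, hX.eq_of_src (𝟙 _) 0]
  simp

variable {f : X →ₗ[A] Y} {g : Y →ₗ[A] Z}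

theorem exists_shortExact (hf : Function.Injective f) (h : Function.Exact f g)
    (hg : Function.Surjective g) :
    ∃ w, (ShortComplex.mk (ModuleCat.ofHom f) (ModuleCat.ofHom g) w).ShortExact := by
  have w : ModuleCat.ofHom f ≫ ModuleCat.ofHom g = 0 := by
    rw [← ModuleCat.ofHom_comp, h.linearMap_comp_eq_zero, ModuleCat.ofHom_zero]
  exact ⟨w, ModuleCat.shortComplex_shortExact _ h hf hg⟩

/-- Here and below, the name tells for which term of 0 → X → Y → Z → 0 the vanishing is deduced;
each is one segment of the contravariant long exact sequence. -/
theorem ExtVanishes.third (hf : Function.Injective f) (h : Function.Exact f g)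
    (hg : Function.Surjective g) {i : ℕ} (hX : ExtVanishes A i X I)
    (hY : ExtVanishes A (i + 1) Y I) : ExtVanishes A (i + 1) Z I := by
  obtain ⟨w, hS⟩ := exists_shortExact hf h hg
  unfold ExtVanishes at hX hY
  refine subsingleton_of_forall_eq 0 fun x => ?_
  obtain ⟨y, rfl⟩ := Ext.contravariant_sequence_exact₃ hS _ x
    (Subsingleton.elim (h := hY) _ _) (add_comm 1 i)
  rw [Subsingleton.elim (h := hX) y 0, Ext.comp_zero]

theorem ExtVanishes.second (hf : Function.Injective f) (h : Function.Exact f g)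
    (hg : Function.Surjective g) {i : ℕ} (hX : ExtVanishes A i X I)
    (hZ : ExtVanishes A i Z I) : ExtVanishes A i Y I := by
  obtain ⟨w, hS⟩ := exists_shortExact hf h hg
  unfold ExtVanishes at hX hZ
  refine subsingleton_of_forall_eq 0 fun x => ?_
  obtain ⟨y, rfl⟩ := Ext.contravariant_sequence_exact₂ hS _ x (Subsingleton.elim (h := hX) _ _)
  rw [Subsingleton.elim (h := hZ) y 0, Ext.comp_zero]

theorem ExtVanishes.first (hf : Function.Injective f) (h : Function.Exact f g)
    (hg : Function.Surjective g) {i : ℕ} (hY : ExtVanishes A i Y I)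
    (hZ : ExtVanishes A (i + 1) Z I) : ExtVanishes A i X I := by
  obtain ⟨w, hS⟩ := exists_shortExact hf h hg
  unfold ExtVanishes at hY hZ
  refine subsingleton_of_forall_eq 0 fun x => ?_
  obtain ⟨y, rfl⟩ := Ext.contravariant_sequence_exact₁ hS _ x (add_comm 1 i)
    (Subsingleton.elim (h := hZ) _ _)
  rw [Subsingleton.elim (h := hY) y 0, Ext.comp_zero]

theorem ExtVanishes.exists_extension (hf : Function.Injective f) (h : Function.Exact f g)
    (hg : Function.Surjective g) (hZ : ExtVanishes A 1 Z I) (φ : X →ₗ[A] I) :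
    ∃ ψ : Y →ₗ[A] I, ψ ∘ₗ f = φ := by
  obtain ⟨w, hS⟩ := exists_shortExact hf h hg
  unfold ExtVanishes at hZ
  obtain ⟨y, hy⟩ := Ext.contravariant_sequence_exact₁ hS (ModuleCat.of A I)
    (Ext.mk₀ (ModuleCat.ofHom φ)) (add_zero 1) (Subsingleton.elim (h := hZ) _ _)
  obtain ⟨ψ, rfl⟩ := (Ext.mk₀_bijective _ _).2 y
  rw [Ext.mk₀_comp_mk₀] at hy
  exact ⟨ψ.hom, congrArg ModuleCat.Hom.hom ((Ext.mk₀_bijective _ _).1 hy)⟩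

/-- When Ext^1(Y, I) = 0, the group Ext^1(Z, I) is the cokernel of restriction Hom(Y, I) → Hom(X,
I). -/
theorem ExtVanishes.one_of_extension (hf : Function.Injective f) (h : Function.Exact f g)
    (hg : Function.Surjective g) (hY : ExtVanishes A 1 Y I)
    (ext : ∀ φ : X →ₗ[A] I, ∃ ψ : Y →ₗ[A] I, ψ ∘ₗ f = φ) : ExtVanishes A 1 Z I := by
  obtain ⟨w, hS⟩ := exists_shortExact hf h hg
  unfold ExtVanishes at hY
  refine subsingleton_of_forall_eq 0 fun x => ?_
  obtain ⟨y, rfl⟩ := Ext.contravariant_sequence_exact₃ hS _ x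
    (Subsingleton.elim (h := hY) _ _) (add_zero 1)
  obtain ⟨φ, rfl⟩ := (Ext.mk₀_bijective _ _).2 y
  obtain ⟨ψ, hψ⟩ := ext φ.hom
  have : φ = ModuleCat.ofHom f ≫ ModuleCat.ofHom ψ := by
    rw [← ModuleCat.ofHom_comp, hψ]; rfl
  rw [this, ← Ext.mk₀_comp_mk₀]
  exact hS.extClass_comp_assoc (Ext.mk₀ (ModuleCat.ofHom ψ))

end Ext

/-! ### Finitely `n`-presented modules -/

section FreePresentation

variable {A : Type u} [Ring A] {U V W : Type u} [AddCommGroup U] [Module A U]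
  [AddCommGroup V] [Module A V] [AddCommGroup W] [Module A W]

/-- Dropping the last term of a free presentation gives a presentation of the first syzygy. -/
def FreePresentation.shift {n : ℕ∞} (P : FreePresentation A (n + 1) U) :
    FreePresentation A n (LinearMap.ker P.aug) where
  rank i := P.rank (i + 1)
  aug := (P.diff 0).codRestrict _ fun x => (P.exact_zero (by simp)).apply_apply_eq_zero x
  diff i := P.diff (i + 1)
  aug_surjective := by
    rintro ⟨x, hx⟩
    obtain ⟨y, hy⟩ := (P.exact_zero (by simp) x).1 hx
    exact ⟨y, Subtype.ext hy⟩
  exact_zero hn x := by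
    rw [← P.exact_succ 0 (by simpa [one_add_one_eq_two] using add_le_add_left hn 1) x]
    exact Subtype.ext_iff
  exact_succ i hn := P.exact_succ (i + 1) (by
    have := add_le_add_left hn 1
    push_cast at this ⊢
    rwa [add_right_comm] at this)

theorem FreePresentation.ker_shift_aug {n : ℕ∞} (P : FreePresentation A (n + 1) U) :
    LinearMap.ker P.shift.aug = LinearMap.ker (P.diff 0) := LinearMap.ker_codRestrict _ _ _

theorem IsFinitelyNPresented.exists_surjective {n : ℕ∞} (h : IsFinitelyNPresented A (n + 1) U) :
    ∃ (m : ℕ) (π : (Fin m → A) →ₗ[A] U), Function.Surjective π ∧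
      IsFinitelyNPresented A n (LinearMap.ker π) := by
  obtain ⟨P⟩ := h
  exact ⟨_, P.aug, P.aug_surjective, ⟨P.shift⟩⟩

theorem IsFinitelyNPresented.mono {n n' : ℕ∞} (h : IsFinitelyNPresented A n U) (hn : n' ≤ n) :
    IsFinitelyNPresented A n' U := by
  obtain ⟨P⟩ := h
  exact ⟨{ P with
    exact_zero := fun h => P.exact_zero (h.trans hn)
    exact_succ := fun i h => P.exact_succ i (h.trans hn) }⟩

theorem IsFinitelyNPresented.congr {n : ℕ∞} (h : IsFinitelyNPresented A n U) (e : U ≃ₗ[A] V) :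
    IsFinitelyNPresented A n V := by
  obtain ⟨P⟩ := h
  exact ⟨{ P with
    aug := e.toLinearMap ∘ₗ P.aug
    aug_surjective := e.surjective.comp P.aug_surjective
    exact_zero := fun h x => by
      rw [← P.exact_zero h x]
      simp }⟩

theorem IsFinitelyNPresented.finite {n : ℕ∞} (h : IsFinitelyNPresented A n U) :
    Module.Finite A U := by
  obtain ⟨P⟩ := h
  exact Module.Finite.of_surjective P.aug P.aug_surjective

theorem IsFinitelyNPresented.finitePresentation {n : ℕ∞}
    (h : IsFinitelyNPresented A (n + 1) U) : Module.FinitePresentation A U := by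
  obtain ⟨m, π, hπ, hk⟩ := h.exists_surjective
  exact Module.finitePresentation_of_surjective π hπ (Module.Finite.iff_fg.1 hk.finite)

variable (A) in
/-- A family of predicates compatible with dimension shifting. -/
def IsShiftFamily (T : ℕ → ∀ (V : Type u) [AddCommGroup V] [Module A V], Prop) : Prop :=
  ∀ (i : ℕ) (V : Type u) [AddCommGroup V] [Module A V] (m : ℕ) (π : (Fin m → A) →ₗ[A] V),
    Function.Surjective π → (T (i + 1) V ↔ T i (LinearMap.ker π))

/-- `V` is the dth syzygy of `U`; two further steps of the presentation remain, which makes both `V`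
and `ker π` finitely presented. The family `T` is quantified after `V` and `π`, so one syzygy serves
for all coefficient modules at once, and for Tor as well as Ext. -/
theorem IsFinitelyNPresented.exists_syzygy {n : ℕ∞} (d : ℕ) {U : Type u} [AddCommGroup U]
    [Module A U] (h : IsFinitelyNPresented A (n + 2 + d) U) :
    ∃ (V : Type u) (_ : AddCommGroup V) (_ : Module A V) (m : ℕ) (π : (Fin m → A) →ₗ[A] V),
      Function.Surjective π ∧ Module.FinitePresentation A V ∧
      Module.FinitePresentation A (LinearMap.ker π) ∧
      ∀ T : ℕ → ∀ (V : Type u) [AddCommGroup V] [Module A V], Prop, IsShiftFamily A T →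
        (T d U ↔ T 0 V) := by
  induction d generalizing U with
  | zero =>
    have h' : IsFinitelyNPresented A (n + 1 + 1) U := by
      rwa [add_assoc, one_add_one_eq_two, ← add_zero (n + 2)]
    obtain ⟨m, π, hπ, hk⟩ := h'.exists_surjective
    exact ⟨U, _, _, m, π, hπ, h'.finitePresentation, hk.finitePresentation, fun _ _ => Iff.rfl⟩
  | succ d ih =>
    have h' : IsFinitelyNPresented A (n + 2 + d + 1) U := by
      rw [add_assoc (n + 2)]
      exact_mod_cast h
    obtain ⟨m, π, hπ, hk⟩ := h'.exists_surjective
    obtain ⟨V, i1, i2, m', π', hπ', h1, h2, h3⟩ := ih hk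
    exact ⟨V, i1, i2, m', π', hπ', h1, h2, fun T hT => (hT d U m π hπ).trans (h3 T hT)⟩

theorem isShiftFamily_ext (I : Type u) [AddCommGroup I] [Module A I] :
    IsShiftFamily A fun i V _ _ => ExtVanishes A (i + 1) V I := fun _ _ _ _ _ π hπ =>
  ⟨fun h => .first (Submodule.subtype_injective _) (LinearMap.exact_subtype_ker_map π) hπ
    (.of_projective _) h,
   fun h => .third (Submodule.subtype_injective _) (LinearMap.exact_subtype_ker_map π) hπ
    h (.of_projective _)⟩

theorem extVanishes_one_iff {G : Type u} [AddCommGroup G] [Module A G] [Module.Projective A G]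
    {I : Type u} [AddCommGroup I] [Module A I] {π : G →ₗ[A] V} (hπ : Function.Surjective π) :
    ExtVanishes A 1 V I ↔
      ∀ φ : LinearMap.ker π →ₗ[A] I, ∃ ψ : G →ₗ[A] I, ψ ∘ₗ (LinearMap.ker π).subtype = φ :=
  ⟨fun h φ => h.exists_extension (Submodule.subtype_injective _)
    (LinearMap.exact_subtype_ker_map π) hπ φ,
   fun h => .one_of_extension (Submodule.subtype_injective _)
    (LinearMap.exact_subtype_ker_map π) hπ (.of_projective _) h⟩

end FreePresentation

theorem isShiftFamily_torR {R : Type u} [Ring R] (N : Type u) [AddCommGroup N] [Module R N] :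
    IsShiftFamily Rᵐᵒᵖ fun i V _ _ => Subsingleton (torR R (i + 1) V N) :=
  fun i _ _ _ _ π hπ => subsingleton_torR_succ_iff N π hπ i

/-! ### Super finitely presented modules -/

section SuperFinitelyPresented

variable {A : Type u} [Ring A]

/-- A class of modules in which every module is a quotient of a finitely generated free module by
a module of the class consists of super finitely presented modules. -/
theorem isFinitelyNPresented_top_of_coinduction (p : ModuleCat.{u} A → Prop)
    (hp : ∀ U, p U → ∃ (W : ModuleCat.{u} A) (G : Type u) (_ : AddCommGroup G) (_ : Module A G)
      (_ : Module.Free A G) (_ : Module.Finite A G) (ι : W →ₗ[A] G) (π : G →ₗ[A] U),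
      p W ∧ Function.Injective ι ∧ Function.Exact ι π ∧ Function.Surjective π)
    (U : ModuleCat.{u} A) (hU : p U) : IsFinitelyNPresented A ⊤ U := by
  have hp' : ∀ U : {U // p U}, ∃ (W : {U // p U}) (m : ℕ) (ι : W.1 →ₗ[A] (Fin m → A))
      (π : (Fin m → A) →ₗ[A] U.1), Function.Injective ι ∧ Function.Exact ι π ∧
      Function.Surjective π := by
    rintro ⟨U, hU⟩
    obtain ⟨W, G, _, _, _, _, ι, π, hW, hι, hex, hπ⟩ := hp U hU
    -- Over the zero ring a basis of a finite module can be infinite, so this case is treated apart.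
    cases subsingleton_or_nontrivial A with
    | inl h =>
      have (M : Type u) [AddCommGroup M] [Module A M] : Subsingleton M :=
        Module.subsingleton A M
      exact ⟨⟨W, hW⟩, 0, 0, 0, Function.injective_of_subsingleton _,
        fun x => ⟨fun _ => ⟨0, Subsingleton.elim _ _⟩, fun _ => Subsingleton.elim _ _⟩,
        fun x => ⟨0, Subsingleton.elim (h := this U) _ _⟩⟩
    | inr h =>
      let e : G ≃ₗ[A] (Fin _ → A) :=
        ((Module.Free.chooseBasis A G).reindex (Fintype.equivFin _)).equivFun
      refine ⟨⟨W, hW⟩, _, e.toLinearMap ∘ₗ ι, π ∘ₗ e.symm.toLinearMap,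
        e.injective.comp hι, fun x => ?_, hπ.comp e.symm.surjective⟩
      refine (hex (e.symm x)).trans ⟨?_, ?_⟩
      · rintro ⟨w, hw⟩
        exact ⟨w, by simp [hw]⟩
      · rintro ⟨w, rfl⟩
        exact ⟨w, by simp⟩
  choose next m ι π hι hex hπ using hp'
  -- The successive syzygies; splicing the chosen short exact sequences gives the resolution.
  let s : ℕ → {U // p U} := fun i => Nat.rec ⟨U, hU⟩ (fun _ V => next V) i
  exact ⟨{
    rank := fun i => m (s i)
    aug := π (s 0)
    diff := fun i => ι (s i) ∘ₗ π (s (i + 1))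
    aug_surjective := hπ (s 0)
    exact_zero := fun _ x => by
      refine (hex (s 0) x).trans ⟨?_, ?_⟩
      · rintro ⟨w, rfl⟩
        obtain ⟨y, rfl⟩ := hπ (s 1) w
        exact ⟨y, rfl⟩
      · rintro ⟨y, rfl⟩
        exact ⟨_, rfl⟩
    exact_succ := fun i _ x => by
      refine (map_eq_zero_iff _ (hι (s i))).trans ((hex (s (i + 1)) x).trans ⟨?_, ?_⟩)
      · rintro ⟨w, rfl⟩
        obtain ⟨y, rfl⟩ := hπ (s (i + 2)) w
        exact ⟨y, rfl⟩
      · rintro ⟨y, rfl⟩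
        exact ⟨_, rfl⟩ }⟩

variable {X Y Z : Type u} [AddCommGroup X] [Module A X] [AddCommGroup Y] [Module A Y]
  [AddCommGroup Z] [Module A Z]

theorem IsFinitelyNPresented.exists_surjective_top (h : IsFinitelyNPresented A ⊤ X) :
    ∃ (m : ℕ) (π : (Fin m → A) →ₗ[A] X), Function.Surjective π ∧
      IsFinitelyNPresented A ⊤ (LinearMap.ker π) :=
  exists_surjective (n := ⊤) h

variable {f : X →ₗ[A] Y} {g : Y →ₗ[A] Z}

theorem IsFinitelyNPresented.top_of_free (hf : Function.Injective f) (h : Function.Exact f g)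
    (hg : Function.Surjective g) [Module.Free A Y] [Module.Finite A Y]
    (hX : IsFinitelyNPresented A ⊤ X) : IsFinitelyNPresented A ⊤ Z := by
  refine isFinitelyNPresented_top_of_coinduction
    (fun V => IsFinitelyNPresented A ⊤ V ∨ V = ModuleCat.of A Z) ?_ (.of A Z) (.inr rfl)
  rintro V (hV | rfl)
  · obtain ⟨m, π, hπ, hk⟩ := hV.exists_surjective_top
    exact ⟨.of A (LinearMap.ker π), _, _, _, inferInstance, inferInstance,
      (LinearMap.ker π).subtype, π, .inl hk, Submodule.subtype_injective _,
      LinearMap.exact_subtype_ker_map π, hπ⟩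
  · exact ⟨.of A X, Y, _, _, inferInstance, inferInstance, f, g, .inl hX, hf, h, hg⟩

theorem IsFinitelyNPresented.top_of_subsingleton [Subsingleton X] :
    IsFinitelyNPresented A ⊤ X := by
  refine isFinitelyNPresented_top_of_coinduction (fun V => Subsingleton V) ?_ (.of A X)
    (inferInstanceAs (Subsingleton X))
  intro V hV
  exact ⟨V, Fin 0 → A, _, _, inferInstance, inferInstance, 0, 0, hV,
    Function.injective_of_subsingleton _,
    fun x => ⟨fun _ => ⟨0, Subsingleton.elim _ _⟩, fun _ => Subsingleton.elim _ _⟩,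
    fun x => ⟨0, Subsingleton.elim _ _⟩⟩

theorem IsFinitelyNPresented.top_self : IsFinitelyNPresented A ⊤ A :=
  top_of_free (X := PUnit.{u + 1}) (f := 0) (g := (LinearMap.id : A →ₗ[A] A))
    (Function.injective_of_subsingleton _)
    (fun x => ⟨fun h => ⟨0, h.symm⟩, by rintro ⟨_, rfl⟩; rfl⟩)
    Function.surjective_id top_of_subsingleton

/-- The horseshoe lemma, for the first syzygies. -/
theorem exists_horseshoe {G H : Type u} [AddCommGroup G] [Module A G] [AddCommGroup H]
    [Module A H] [Module.Projective A H] (hf : Function.Injective f) (h : Function.Exact f g)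
    (hg : Function.Surjective g) (π : G →ₗ[A] X) (ρ : H →ₗ[A] Z)
    (hπ : Function.Surjective π) (hρ : Function.Surjective ρ) :
    ∃ σ : G × H →ₗ[A] Y, Function.Surjective σ ∧
      ∃ (f' : LinearMap.ker π →ₗ[A] LinearMap.ker σ) (g' : LinearMap.ker σ →ₗ[A] LinearMap.ker ρ),
        Function.Injective f' ∧ Function.Exact f' g' ∧ Function.Surjective g' := by
  obtain ⟨l, hl⟩ := Module.projective_lifting_property g ρ hg
  have hl' : ∀ x, g (l x) = ρ x := fun x => LinearMap.congr_fun hl x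
  have hgf : ∀ x, g (f x) = 0 := h.apply_apply_eq_zero
  refine ⟨(f ∘ₗ π).coprod l, ?_, ?_⟩
  · intro y
    obtain ⟨b, hb⟩ := hρ (g y)
    obtain ⟨x, hx⟩ := (h (y - l b)).1 (by rw [map_sub, hl', hb, sub_self])
    obtain ⟨a, rfl⟩ := hπ x
    exact ⟨(a, b), by simp [hx]⟩
  · refine ⟨(LinearMap.inl A G H).restrict ?_, (LinearMap.snd A G H).restrict ?_, ?_, ?_, ?_⟩
    · intro x hx
      simp only [LinearMap.mem_ker] at hx
      simp [hx]
    · rintro ⟨a, b⟩ hx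
      have := congrArg g hx
      simpa [hgf, hl'] using this
    · intro x y hxy
      have := congrArg (fun z : LinearMap.ker ((f ∘ₗ π).coprod l) => z.1.1) hxy
      exact Subtype.ext this
    · rintro ⟨⟨a, b⟩, hx⟩
      constructor
      · intro hb
        obtain rfl : b = 0 := congrArg Subtype.val hb
        refine ⟨⟨a, ?_⟩, rfl⟩
        simp only [LinearMap.mem_ker, LinearMap.coprod_apply, map_zero, add_zero] at hx
        exact hf (by simpa using hx)
      · rintro ⟨x, hx'⟩
        exact Subtype.ext
          (congrArg (fun z : LinearMap.ker ((f ∘ₗ π).coprod l) => z.1.2) hx').symm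
    · rintro ⟨b, hb⟩
      obtain ⟨x, hx⟩ := (h (l b)).1 (by rw [hl']; exact hb)
      obtain ⟨a, rfl⟩ := hπ x
      -- Since `l b = f (π a)`, the sign puts the pair in the kernel of `(f ∘ₗ π).coprod l`.
      exact ⟨⟨(-a, b), by simp [hx]⟩, rfl⟩

theorem IsFinitelyNPresented.top_of_extension (hf : Function.Injective f)
    (h : Function.Exact f g) (hg : Function.Surjective g) (hX : IsFinitelyNPresented A ⊤ X)
    (hZ : IsFinitelyNPresented A ⊤ Z) : IsFinitelyNPresented A ⊤ Y := by
  refine isFinitelyNPresented_top_of_coinduction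
    (fun V => ∃ (X Z : ModuleCat.{u} A) (f : X →ₗ[A] V) (g : V →ₗ[A] Z), Function.Injective f ∧
      Function.Exact f g ∧ Function.Surjective g ∧ IsFinitelyNPresented A ⊤ X ∧
      IsFinitelyNPresented A ⊤ Z) ?_ (.of A Y) ⟨.of A X, .of A Z, f, g, hf, h, hg, hX, hZ⟩
  rintro V ⟨X, Z, f, g, hf, h, hg, hX, hZ⟩
  obtain ⟨m, π, hπ, hk⟩ := hX.exists_surjective_top
  obtain ⟨m', ρ, hρ, hk'⟩ := hZ.exists_surjective_top
  obtain ⟨σ, hσ, f', g', h1, h2, h3⟩ := exists_horseshoe hf h hg π ρ hπ hρ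
  exact ⟨.of A (LinearMap.ker σ), _, _, _, inferInstance, inferInstance,
    (LinearMap.ker σ).subtype, σ, ⟨.of A _, .of A _, f', g', h1, h2, h3, hk, hk'⟩,
    Submodule.subtype_injective _, LinearMap.exact_subtype_ker_map σ, hσ⟩

/-- Cover Y by a finitely generated free module. The kernel of the composite onto Z is an extension
of ker g ≅ X by ker π, hence super finitely presented. -/
theorem IsFinitelyNPresented.top_of_cokernel (hf : Function.Injective f)
    (h : Function.Exact f g) (hg : Function.Surjective g) (hX : IsFinitelyNPresented A ⊤ X)
    (hY : IsFinitelyNPresented A ⊤ Y) : IsFinitelyNPresented A ⊤ Z := by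
  obtain ⟨m, π, hπ, hk⟩ := hY.exists_surjective_top
  have hE : IsFinitelyNPresented A ⊤ (LinearMap.ker (g ∘ₗ π)) := by
    have hX' : IsFinitelyNPresented A ⊤ (LinearMap.ker g) :=
      hX.congr ((LinearEquiv.ofInjective f hf).trans (LinearEquiv.ofEq _ _
        (LinearMap.exact_iff.1 h).symm))
    refine top_of_extension (f := Submodule.inclusion (LinearMap.ker_le_ker_comp π g))
      (g := π.restrict (p := LinearMap.ker (g ∘ₗ π)) (q := LinearMap.ker g) fun x hx => hx)
      (Submodule.inclusion_injective _) ?_ ?_ hk hX'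
    · rintro ⟨x, hx⟩
      constructor
      · intro hx'
        exact ⟨⟨x, congrArg Subtype.val hx'⟩, rfl⟩
      · rintro ⟨⟨y, hy⟩, hxy⟩
        obtain rfl : y = x := congrArg Subtype.val hxy
        exact Subtype.ext hy
    · rintro ⟨y, hy⟩
      obtain ⟨x, rfl⟩ := hπ y
      exact ⟨⟨x, hy⟩, rfl⟩
  exact top_of_free (Submodule.subtype_injective _) (LinearMap.exact_subtype_ker_map (g ∘ₗ π))
    (hg.comp hπ) hE

variable (A X) in
theorem exact_single_funLeft_succ (m : ℕ) :
    Function.Exact (LinearMap.single A (fun _ : Fin (m + 1) => X) 0)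
      (LinearMap.funLeft A X (Fin.succ : Fin m → Fin (m + 1))) := by
  intro x
  constructor
  · intro hx
    refine ⟨x 0, funext fun i => ?_⟩
    cases i using Fin.cases with
    | zero => simp
    | succ i => simpa using (congrFun hx i).symm
  · rintro ⟨y, rfl⟩
    ext i
    simp [LinearMap.funLeft_apply]

theorem pi_induction {p : ∀ (V : Type u) [AddCommGroup V] [Module A V], Prop}
    (zero : ∀ (V : Type u) [AddCommGroup V] [Module A V] [Subsingleton V], p V)
    (ext : ∀ (X Y Z : Type u) [AddCommGroup X] [Module A X] [AddCommGroup Y] [Module A Y]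
      [AddCommGroup Z] [Module A Z] (f : X →ₗ[A] Y) (g : Y →ₗ[A] Z), Function.Injective f →
      Function.Exact f g → Function.Surjective g → p X → p Z → p Y) (hX : p X) (m : ℕ) :
    p (Fin m → X) := by
  induction m with
  | zero => exact zero _
  | succ m ih =>
    exact ext _ _ _ _ _ (Pi.single_injective (M := fun _ : Fin (m + 1) => X) 0)
      (exact_single_funLeft_succ A X m)
      (LinearMap.funLeft_surjective_of_injective _ _ _ (Fin.succ_injective m)) hX ih

theorem IsFinitelyNPresented.top_pi (hX : IsFinitelyNPresented A ⊤ X) (m : ℕ) :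
    IsFinitelyNPresented A ⊤ (Fin m → X) :=
  pi_induction (p := fun V _ _ => IsFinitelyNPresented A ⊤ V) (fun _ => top_of_subsingleton)
    (fun _ _ _ _ _ _ _ _ _ _ _ hf h hg hX hZ => top_of_extension hf h hg hX hZ) hX m

theorem ExtVanishes.pi {I : Type u} [AddCommGroup I] [Module A I] {i : ℕ}
    (hX : ExtVanishes A i X I) (m : ℕ) : ExtVanishes A i (Fin m → X) I :=
  pi_induction (p := fun V _ _ => ExtVanishes A i V I) (fun _ => of_subsingleton i)
    (fun _ _ _ _ _ _ _ _ _ _ _ hf h hg hX hZ => second hf h hg hX hZ) hX m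

end SuperFinitelyPresented

/-! ### Syzygies -/

section Syzygy

variable {A : Type u} [Ring A] {K C : Type u} [AddCommGroup K] [Module A K] [AddCommGroup C]
  [Module A C]

theorem IsSyzygy.succ {d : ℕ} (h : IsSyzygy A (d + 1) K C) :
    ∃ (m : ℕ) (π : (Fin m → A) →ₗ[A] C), Function.Surjective π ∧
      IsSyzygy A d K (LinearMap.ker π) := by
  obtain ⟨P, hP⟩ := h
  refine ⟨_, P.aug, P.aug_surjective, FreePresentation.shift (n := ⊤) P, ?_⟩
  match d with
  | 0 => exact hP
  | 1 =>
    obtain ⟨e⟩ := hP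
    exact ⟨e.trans (LinearEquiv.ofEq _ _ (FreePresentation.ker_shift_aug (n := ⊤) P).symm)⟩
  | d + 2 => exact hP

theorem IsSyzygy.isFinitelyNPresented {d : ℕ} (h : IsSyzygy A d K C) :
    IsFinitelyNPresented A ⊤ K := by
  induction d generalizing C with
  | zero =>
    obtain ⟨P, ⟨e⟩⟩ := h
    exact IsFinitelyNPresented.congr ⟨P⟩ e.symm
  | succ d ih =>
    obtain ⟨m, π, -, h'⟩ := h.succ
    exact ih h'

/-- Higher vanishing for modules that are `(∞, d)`-injective. -/
theorem extVanishes_of_le {d : ℕ} {I : Type u} [AddCommGroup I] [Module A I]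
    (hI : ∀ (U : Type u) [AddCommGroup U] [Module A U], IsFinitelyNPresented A ⊤ U →
      ExtVanishes A (d + 1) U I) (j : ℕ) {U : Type u} [AddCommGroup U] [Module A U]
    (hU : IsFinitelyNPresented A ⊤ U) : ExtVanishes A (d + j + 1) U I := by
  induction j generalizing U with
  | zero => exact hI U hU
  | succ j ih =>
    obtain ⟨m, π, hπ, hk⟩ := hU.exists_surjective_top
    exact (isShiftFamily_ext I (d + j) U m π hπ).2 (ih hk)

theorem IsSyzygy.extVanishes_iff {d : ℕ} (h : IsSyzygy A d K C) {I : Type u} [AddCommGroup I]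
    [Module A I] (i : ℕ) : ExtVanishes A (d + i + 1) C I ↔ ExtVanishes A (i + 1) K I := by
  induction d generalizing C with
  | zero =>
    obtain ⟨P, ⟨e⟩⟩ := h
    rw [zero_add]
    exact ⟨fun h => h.congr_left e.symm, fun h => h.congr_left e⟩
  | succ d ih =>
    obtain ⟨m, π, hπ, h'⟩ := h.succ
    rw [← ih h', add_right_comm d 1 i]
    exact isShiftFamily_ext I (d + i) C m π hπ

theorem IsSyzygy.isFinitelyNPresented_right {d : ℕ} (h : IsSyzygy A d K C) :
    IsFinitelyNPresented A ⊤ C := by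
  obtain ⟨P, -⟩ := h
  exact ⟨P⟩

/-- This is what the syzygy condition is for: in the indexing of `IsSyzygy`, K lies d steps above C,
so Ext^{i+1}(K, I) = Ext^{d+i+1}(C, I), and the degree d + i + 1 is in the range where `I` has no
Ext from super finitely presented modules. -/
theorem IsSyzygy.extVanishes {d : ℕ} (h : IsSyzygy A d K C) {I : Type u} [AddCommGroup I]
    [Module A I]
    (hI : ∀ (U : Type u) [AddCommGroup U] [Module A U], IsFinitelyNPresented A ⊤ U →
      ExtVanishes A (d + 1) U I) (i : ℕ) : ExtVanishes A (i + 1) K I :=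
  (h.extVanishes_iff i).1 (extVanishes_of_le hI i h.isFinitelyNPresented_right)

end Syzygy

/-! ### Coresolutions by a module with vanishing self-extensions -/

theorem Function.Exact.exists_factor {A : Type*} [Ring A] {X Y Z I : Type*} [AddCommGroup X]
    [Module A X] [AddCommGroup Y] [Module A Y] [AddCommGroup Z] [Module A Z] [AddCommGroup I]
    [Module A I] {f : X →ₗ[A] Y} {g : Y →ₗ[A] Z} (h : Function.Exact f g)
    (hg : Function.Surjective g) (ψ : Y →ₗ[A] I) (hψ : ψ ∘ₗ f = 0) :
    ∃ χ : Z →ₗ[A] I, χ ∘ₗ g = ψ := by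
  refine ⟨(LinearMap.ker g).liftQ ψ ?_ ∘ₗ (g.quotKerEquivOfSurjective hg).symm.toLinearMap, ?_⟩
  · intro y hy
    obtain ⟨x, rfl⟩ := (h y).1 hy
    exact LinearMap.congr_fun hψ x
  · ext y
    have : (g.quotKerEquivOfSurjective hg).symm (g y) = (LinearMap.ker g).mkQ y := by
      rw [LinearEquiv.symm_apply_eq]
      rfl
    simp [this]

section Hom

variable (A : Type u) {B K U V : Type u} [Ring A] [Ring B] [AddCommGroup K] [Module A K]
  [Module B K] [SMulCommClass B A K] [AddCommGroup U] [Module B U] [AddCommGroup V] [Module B V]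

variable (K) in
/-- Precomposition with a `B`-linear map, as an `A`-linear map. -/
def homPrecomp (π : V →ₗ[B] U) : (U →ₗ[B] K) →ₗ[A] (V →ₗ[B] K) where
  toFun φ := φ ∘ₗ π
  map_add' _ _ := rfl
  map_smul' _ _ := rfl

variable {π : V →ₗ[B] U} (hπ : Function.Surjective π)

include hπ

theorem homPrecomp_injective : Function.Injective (homPrecomp A K π) := fun _ _ h =>
  (LinearMap.cancel_right hπ).1 h

theorem homPrecomp_exact :
    Function.Exact (homPrecomp A K π) (homPrecomp A K (LinearMap.ker π).subtype) := by
  intro ψ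
  constructor
  · exact fun h => (LinearMap.exact_subtype_ker_map π).exists_factor hπ ψ h
  · rintro ⟨φ, rfl⟩
    ext x
    simp [homPrecomp]

theorem homPrecomp_surjective (h : ExtVanishes B 1 U K) :
    Function.Surjective (homPrecomp A K (LinearMap.ker π).subtype) :=
  h.exists_extension (Submodule.subtype_injective _) (LinearMap.exact_subtype_ker_map π) hπ

end Hom

section Coresolution

variable {A B K I : Type u} [Ring A] [Ring B] [AddCommGroup K] [Module A K]
  [Module B K] [SMulCommClass B A K] [AddCommGroup I] [Module A I]

variable (A B K) in
/-- `Hom_B(B^m, K) = K^m`. -/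
def homFreeEquiv (m : ℕ) : (Fin m → K) ≃ₗ[A] ((Fin m → B) →ₗ[B] K) :=
  (Pi.basisFun B (Fin m)).constr A

theorem homFreeEquiv_apply (m : ℕ) (x : Fin m → K) (b : Fin m → B) :
    homFreeEquiv A B K m x b = ∑ i, b i • x i := by
  simp [homFreeEquiv, Module.Basis.constr_apply_fintype]

theorem homFreeEquiv_eq (m : ℕ) (π : (Fin m → B) →ₗ[B] K) :
    homFreeEquiv A B K m (fun i => π (Pi.single i 1)) = π := by
  refine (Pi.basisFun B (Fin m)).ext fun i => ?_
  simp [homFreeEquiv]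

/-- The modules to which coresolutions are applied. -/
structure IsCoresolvable (A B K U : Type u) [Ring A] [Ring B] [AddCommGroup K] [Module A K]
    [Module B K] [SMulCommClass B A K] [AddCommGroup U] [Module B U] : Prop where
  presented : IsFinitelyNPresented B ⊤ U
  ext : ∀ i, ExtVanishes B (i + 1) U K
  hom_presented : IsFinitelyNPresented A ⊤ (U →ₗ[B] K)

/-- Because Ext^1_B(U, K) = 0, the sequence 0 → Hom_B(U, K) → K^m → Hom_B(ker π, K) → 0 is exact, so
its last term is super finitely presented over `A`. Iteration coresolves Hom_B(U, K) by powers of K.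
-/
theorem IsCoresolvable.exists_ker (hK : IsFinitelyNPresented A ⊤ K) {U : Type u} [AddCommGroup U]
    [Module B U] (hU : IsCoresolvable A B K U) :
    ∃ (m : ℕ) (π : (Fin m → B) →ₗ[B] U), Function.Surjective π ∧
      IsCoresolvable A B K (LinearMap.ker π) := by
  obtain ⟨m, π, hπ, hk⟩ := hU.presented.exists_surjective_top
  refine ⟨m, π, hπ, hk, fun i => (isShiftFamily_ext K i U m π hπ).1 (hU.ext (i + 1)), ?_⟩
  exact .top_of_cokernel (homPrecomp_injective A hπ) (homPrecomp_exact A hπ)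
    (homPrecomp_surjective A hπ (hU.ext 0)) hU.hom_presented
    ((hK.top_pi m).congr (homFreeEquiv A B K m))

/-- As Ext^{≥1}_A(K, I) = 0, each step of the coresolution raises the degree of Ext by one; after k
= d - i steps the degree is d + 1, where `hI` applies to the super finitely presented cosyzygy. -/
theorem IsCoresolvable.extVanishes (hK : IsFinitelyNPresented A ⊤ K)
    (hKI : ∀ i, ExtVanishes A (i + 1) K I) {d : ℕ}
    (hI : ∀ (U : Type u) [AddCommGroup U] [Module A U], IsFinitelyNPresented A ⊤ U →
      ExtVanishes A (d + 1) U I) (k i : ℕ) (hik : i + k = d) {U : Type u} [AddCommGroup U]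
    [Module B U] (hU : IsCoresolvable A B K U) : ExtVanishes A (i + 1) (U →ₗ[B] K) I := by
  induction k generalizing i U with
  | zero =>
    obtain rfl : i = d := hik
    exact hI _ hU.hom_presented
  | succ k ih =>
    obtain ⟨m, π, hπ, hk⟩ := hU.exists_ker hK
    exact .first (homPrecomp_injective A hπ) (homPrecomp_exact A hπ)
      (homPrecomp_surjective A hπ (hU.ext 0))
      (((hKI i).pi m).congr_left (homFreeEquiv A B K m)) (ih (i + 1) (by omega) hk)

/-- The output of the coresolution argument: `K` is presented over `B` by generators `k` and
relations `a`, and the complex `A → K^{m₀} → K^{m₁}` of `A`-modules that they define becomes exact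
after applying `Hom_A(-, I)`. -/
theorem exists_coresolution (hK : IsFinitelyNPresented A ⊤ K) (hKB : IsFinitelyNPresented B ⊤ K)
    (hext : ∀ i, ExtVanishes B (i + 1) K K)
    (hhom : Function.Bijective
      (LinearMap.toSpanSingleton A (K →ₗ[B] K) (LinearMap.id : K →ₗ[B] K)))
    (hKI : ∀ i, ExtVanishes A (i + 1) K I) {d : ℕ}
    (hI : ∀ (U : Type u) [AddCommGroup U] [Module A U], IsFinitelyNPresented A ⊤ U →
      ExtVanishes A (d + 1) U I) :
    ∃ (m₀ m₁ : ℕ) (k : Fin m₀ → K) (a : Fin m₁ → Fin m₀ → B),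
      (∀ x : K, ∃ b : Fin m₀ → B, x = ∑ i, b i • k i) ∧
      (∀ j, ∑ i, a j i • k i = 0) ∧
      (∀ x : I, ∃ φ : Fin m₀ → (K →ₗ[A] I), ∑ i, φ i (k i) = x) ∧
      (∀ φ : Fin m₀ → (K →ₗ[A] I), ∑ i, φ i (k i) = 0 →
        ∃ ψ : Fin m₁ → (K →ₗ[A] I), ∀ i x, φ i x = ∑ j, ψ j (a j i • x)) := by
  -- The coresolution starts at Hom_B(K, K) ≅ A, which is trivially super finitely presented.
  have hKc : IsCoresolvable A B K K :=
    ⟨hKB, hext, .congr .top_self (LinearEquiv.ofBijective _ hhom)⟩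
  obtain ⟨m₀, π₀, hπ₀, h₁⟩ := hKc.exists_ker hK
  obtain ⟨m₁, π₁, hπ₁, h₂⟩ := h₁.exists_ker hK
  -- Ext^1_A(-, I) vanishes on the first two cosyzygies Hom_B(ker π₀, K) and Hom_B(ker π₁, K); this
  -- gives the two extensions used below.
  have e₁ := h₁.extVanishes hK hKI hI d 0 (zero_add d)
  have e₂ := h₂.extVanishes hK hKI hI d 0 (zero_add d)
  have hk : homFreeEquiv A B K m₀ (fun i => π₀ (Pi.single i 1)) = π₀ := homFreeEquiv_eq m₀ π₀
  have hsum : ∀ b : Fin m₀ → B, π₀ b = ∑ i, b i • π₀ (Pi.single i 1) := fun b => by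
    conv_lhs => rw [← hk]
    rw [homFreeEquiv_apply]
  refine ⟨m₀, m₁, fun i => π₀ (Pi.single i 1), fun j => (π₁ (Pi.single j 1)).1, fun x => ?_,
    fun j => ?_, fun x => ?_, fun φ hφ => ?_⟩
  · obtain ⟨b, rfl⟩ := hπ₀ x
    exact ⟨b, hsum b⟩
  · rw [← hsum]
    exact (π₁ (Pi.single j 1)).2
  -- Extend the map A → I, 1 ↦ x, along A ≅ Hom_B(K, K) → K^{m₀}, which sends 1 to the tuple of
  -- generators.
  · obtain ⟨ψ, hψ⟩ := e₁.exists_extension (homPrecomp_injective A hπ₀) (homPrecomp_exact A hπ₀)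
      (homPrecomp_surjective A hπ₀ (hext 0))
      (LinearMap.toSpanSingleton A I x ∘ₗ (LinearEquiv.ofBijective _ hhom).symm.toLinearMap)
    refine ⟨fun i => ψ ∘ₗ (homFreeEquiv A B K m₀).toLinearMap ∘ₗ
      LinearMap.single A (fun _ => K) i, ?_⟩
    have h1 : (LinearEquiv.ofBijective _ hhom).symm LinearMap.id = 1 := by
      rw [LinearEquiv.symm_apply_eq]
      simp
    have h2 := LinearMap.congr_fun hψ LinearMap.id
    have h3 : homPrecomp A K π₀ LinearMap.id = π₀ := rfl
    simp only [LinearMap.comp_apply, LinearEquiv.coe_coe, h1, h3] at h2 ⊢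
    rw [← map_sum, ← map_sum]
    have h4 : ∑ i, LinearMap.single A (fun _ : Fin m₀ => K) i (π₀ (Pi.single i 1)) =
        fun i => π₀ (Pi.single i 1) := LinearMap.sum_single_apply (fun _ => K) _
    rw [h4, hk, h2]
    simp
  -- The map K^{m₀} → I with components φ kills the image of A, so it factors through Hom_B(ker π₀,
  -- K); that factor then extends to K^{m₁}.
  · let ψ : ((Fin m₀ → B) →ₗ[B] K) →ₗ[A] I :=
      LinearMap.lsum A (fun _ : Fin m₀ => K) ℕ φ ∘ₗ (homFreeEquiv A B K m₀).symm.toLinearMap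
    have hψ : ψ ∘ₗ homPrecomp A K π₀ = 0 := by
      ext θ
      obtain ⟨a, rfl⟩ := hhom.2 θ
      rw [LinearMap.toSpanSingleton_apply, map_smul]
      have h3 : homPrecomp A K π₀ LinearMap.id = π₀ := rfl
      have h5 : (homFreeEquiv A B K m₀).symm π₀ = fun i => π₀ (Pi.single i 1) := by
        rw [LinearEquiv.symm_apply_eq, hk]
      simp [ψ, h3, h5, hφ]
    obtain ⟨χ, hχ⟩ := (homPrecomp_exact A hπ₀).exists_factor
      (homPrecomp_surjective A hπ₀ (hext 0)) ψ hψ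
    obtain ⟨ω, hω⟩ := e₂.exists_extension (homPrecomp_injective A hπ₁) (homPrecomp_exact A hπ₁)
      (homPrecomp_surjective A hπ₁ (h₁.ext 0)) χ
    refine ⟨fun j => ω ∘ₗ (homFreeEquiv A B K m₁).toLinearMap ∘ₗ
      LinearMap.single A (fun _ => K) j, fun i x => ?_⟩
    have h1 : φ i x = ψ (homFreeEquiv A B K m₀ (Pi.single i x)) := by
      simp only [ψ, LinearMap.comp_apply, LinearEquiv.coe_coe, LinearEquiv.symm_apply_apply,
        LinearMap.lsum_apply, LinearMap.sum_apply, LinearMap.proj_apply]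
      rw [Finset.sum_eq_single i (fun j _ hj => by rw [Pi.single_eq_of_ne hj, map_zero]) (by simp),
        Pi.single_eq_same]
    rw [h1, ← hχ, ← hω]
    simp only [LinearMap.comp_apply, LinearEquiv.coe_coe]
    rw [← map_sum, ← map_sum]
    have h4 : ∑ j, LinearMap.single A (fun _ : Fin m₁ => K) j
        ((π₁ (Pi.single j 1)).1 i • x) = fun j => (π₁ (Pi.single j 1)).1 i • x :=
      LinearMap.sum_single_apply (fun _ => K) _
    rw [h4]
    congr 1
    refine (Pi.basisFun B (Fin m₁)).ext fun j => ?_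
    rw [Pi.basisFun_apply, homFreeEquiv_apply]
    simp only [homPrecomp, LinearMap.coe_mk, AddHom.coe_mk, LinearMap.comp_apply,
      Submodule.subtype_apply, homFreeEquiv_apply]
    rw [Finset.sum_eq_single i (fun l _ hl => by rw [Pi.single_eq_of_ne hl, smul_zero]) (by simp),
      Finset.sum_eq_single j (fun l _ hl => by rw [Pi.single_eq_of_ne hl, zero_smul]) (by simp),
      Pi.single_eq_same, Pi.single_eq_same, one_smul]

end Coresolution

/-! ### Lifting maps from finitely presented modules -/

theorem Function.Exact.exists_lift {A : Type*} [Ring A] {X Y Z V : Type*} [AddCommGroup X]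
    [Module A X] [AddCommGroup Y] [Module A Y] [AddCommGroup Z] [Module A Z] [AddCommGroup V]
    [Module A V] {f : X →ₗ[A] Y} {g : Y →ₗ[A] Z} (h : Function.Exact f g)
    (hf : Function.Injective f) (φ : V →ₗ[A] Y) (hφ : g ∘ₗ φ = 0) :
    ∃ ψ : V →ₗ[A] X, f ∘ₗ ψ = φ := by
  refine ⟨(LinearEquiv.ofInjective f hf).symm.toLinearMap ∘ₗ
    φ.codRestrict (LinearMap.range f) fun v => (h (φ v)).1 (LinearMap.congr_fun hφ v), ?_⟩
  ext v
  exact congrArg Subtype.val ((LinearEquiv.ofInjective f hf).apply_symm_apply _)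

section Lifting

variable {A : Type u} [Ring A] {N M Q : Type u} [AddCommGroup N] [Module A N] [AddCommGroup M]
  [Module A M] [AddCommGroup Q] [Module A Q]

/-- Maps from finitely presented modules lift along `g`. -/
def LiftsFinitelyPresented (g : M →ₗ[A] Q) : Prop :=
  ∀ (V : Type u) [AddCommGroup V] [Module A V] [Module.FinitePresentation A V] (h : V →ₗ[A] Q),
    ∃ k : V →ₗ[A] M, g ∘ₗ k = h

variable {f : N →ₗ[A] M} {g : M →ₗ[A] Q}

/-- The cokernel of α is finitely presented, and `h` induces a map from it to Q. Subtracting from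
`h` a lift of that map to M leaves a map with values in N and the same restriction along α. -/
theorem LiftsFinitelyPresented.exists_extension (hg : LiftsFinitelyPresented g)
    (hf : Function.Injective f) (ex : Function.Exact f g) {E B : Type u} [AddCommGroup E]
    [Module A E] [AddCommGroup B] [Module A B] [Module.Finite A E] [Module.FinitePresentation A B]
    (α : E →ₗ[A] B) (h : B →ₗ[A] M) (h' : E →ₗ[A] N) (hh' : f ∘ₗ h' = h ∘ₗ α) :
    ∃ k : B →ₗ[A] N, k ∘ₗ α = h' := by
  have hgf : g ∘ₗ f = 0 := ex.linearMap_comp_eq_zero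
  have hfg : Submodule.FG (LinearMap.ker (LinearMap.range α).mkQ) := by
    rw [Submodule.ker_mkQ]
    rw [← Submodule.map_top]
    exact Module.Finite.fg_top.map α
  have : Module.FinitePresentation A (B ⧸ LinearMap.range α) :=
    Module.finitePresentation_of_surjective _ (Submodule.mkQ_surjective _) hfg
  obtain ⟨k, hk⟩ := hg _ ((LinearMap.range α).liftQ (g ∘ₗ h) (by
    rintro _ ⟨e, rfl⟩
    change (g ∘ₗ (h ∘ₗ α)) e = 0
    rw [← hh', ← LinearMap.comp_assoc, hgf, LinearMap.zero_comp, LinearMap.zero_apply]))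
  obtain ⟨ψ, hψ⟩ := ex.exists_lift hf (h - k ∘ₗ (LinearMap.range α).mkQ) (by
    rw [LinearMap.comp_sub, ← LinearMap.comp_assoc, hk, Submodule.liftQ_mkQ, sub_self])
  refine ⟨ψ, LinearMap.ext fun e => hf ?_⟩
  have h1 := LinearMap.congr_fun hψ (α e)
  have h2 := LinearMap.congr_fun hh' e
  have h3 : (LinearMap.range α).mkQ (α e) = 0 :=
    (Submodule.Quotient.mk_eq_zero _).2 (LinearMap.mem_range_self α e)
  simp only [LinearMap.comp_apply, LinearMap.sub_apply, h3, map_zero, sub_zero] at h1 h2 ⊢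
  rw [h1, h2]

theorem LiftsFinitelyPresented.surjective (hg : LiftsFinitelyPresented g) :
    Function.Surjective g := fun q => by
  obtain ⟨k, hk⟩ := hg A (LinearMap.toSpanSingleton A Q q)
  exact ⟨k 1, by simpa using LinearMap.congr_fun hk 1⟩

/-- To lift maps from finitely presented modules it is enough to correct a lift of the images of
the generators by a solution of linear equations in `N`. -/
theorem liftsFinitelyPresented_of_solutions (ex : Function.Exact f g)
    (hg : Function.Surjective g)
    (H : ∀ (p q : ℕ) (s : Fin q → Fin p → A) (y : Fin p → M) (z : Fin q → N),
      (∀ j, f (z j) = ∑ i, s j i • y i) → ∃ z' : Fin p → N, ∀ j, z j = ∑ i, s j i • z' i) :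
    LiftsFinitelyPresented g := by
  intro V _ _ _ h
  obtain ⟨p, q, π, γ, hπ, hγ⟩ := Module.FinitePresentation.exists_fin' A V
  let s : Fin q → Fin p → A := fun j => γ (Pi.single j 1)
  choose y hy using fun i => hg (h (π (Pi.single i 1)))
  have hsum : ∀ (t : Fin p → A) (X : Type u) [AddCommGroup X] [Module A X]
      (φ : (Fin p → A) →ₗ[A] X), φ t = ∑ i, t i • φ (Pi.single i 1) := fun t X _ _ φ => by
    conv_lhs => rw [← Finset.univ_sum_single t]
    rw [map_sum]
    refine Finset.sum_congr rfl fun i _ => ?_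
    rw [← map_smul, ← Pi.single_smul, smul_eq_mul, mul_one]
  have hsj : ∀ j, π (s j) = 0 := fun j => hγ.apply_apply_eq_zero _
  have hz : ∀ j, ∃ z : N, f z = ∑ i, s j i • y i := fun j => by
    refine (ex _).1 ?_
    have := hsum (s j) Q (h ∘ₗ π)
    simp only [LinearMap.comp_apply, hsj, map_zero] at this
    simp [hy, ← this]
  choose z hz using hz
  obtain ⟨z', hz'⟩ := H p q s y z hz
  let k : (Fin p → A) →ₗ[A] M := (Pi.basisFun A (Fin p)).constr ℕ fun i => y i - f (z' i)
  have hk1 : ∀ i, k (Pi.single i 1) = y i - f (z' i) := fun i => by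
    have := (Pi.basisFun A (Fin p)).constr_basis ℕ (fun i => y i - f (z' i)) i
    rwa [Pi.basisFun_apply] at this
  have hk2 : k ∘ₗ γ = 0 := by
    refine (Pi.basisFun A (Fin q)).ext fun j => ?_
    rw [Pi.basisFun_apply, LinearMap.comp_apply]
    change k (s j) = 0
    rw [hsum]
    simp only [hk1, smul_sub, Finset.sum_sub_distrib, ← map_smul]
    rw [← map_sum, ← hz' j, hz j, sub_self]
  obtain ⟨χ, hχ⟩ := hγ.exists_factor hπ k hk2
  refine ⟨χ, LinearMap.cancel_right hπ |>.1 ?_⟩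
  rw [LinearMap.comp_assoc, hχ]
  refine (Pi.basisFun A (Fin p)).ext fun i => ?_
  rw [Pi.basisFun_apply, LinearMap.comp_apply, hk1, map_sub, hy, ex.apply_apply_eq_zero, sub_zero,
    LinearMap.comp_apply]

end Lifting

/-! ### Purity and the tensor product with a bimodule -/

section Purity

variable {S R K : Type u} [Ring S] [Ring R] [AddCommGroup K] [Module S K] [Module Rᵐᵒᵖ K]
  [SMulCommClass S Rᵐᵒᵖ K]

variable (S R K) in
/-- The `S`-linear map `K ⊗ f`. -/
def balMapL {N M : Type u} [AddCommGroup N] [Module R N] [AddCommGroup M] [Module R M]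
    (f : N →ₗ[R] M) : BalTensor S R K N →ₗ[S] BalTensor S R K M where
  toFun := balMap S S R (LinearMap.id : K →ₗ[Rᵐᵒᵖ] K) f
  map_add' := map_add _
  map_smul' s z := by
    induction z using balTensor_induction with
    | tmul x y => rfl
    | zero => simp
    | add a b ha hb => simp only [smul_add, map_add, ha, hb]

@[simp]
theorem balMapL_tmul {N M : Type u} [AddCommGroup N] [Module R N] [AddCommGroup M] [Module R M]
    (f : N →ₗ[R] M) (x : K) (y : N) :
    balMapL S R K f (balTmul S R x y) = balTmul S R x (f y) := rfl

/-- Coefficients of the right-module generators `x i` can be moved across the tensor sign. -/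
theorem exists_eq_sum_balTmul {T : Type*} [Ring T] {X N : Type u} [AddCommGroup X] [Module T X]
    [Module Rᵐᵒᵖ X] [SMulCommClass T Rᵐᵒᵖ X] [AddCommGroup N] [Module R N] {m : ℕ} {x : Fin m → X}
    (hx : ∀ y : X, ∃ b : Fin m → Rᵐᵒᵖ, y = ∑ i, b i • x i) (z : BalTensor T R X N) :
    ∃ y : Fin m → N, z = ∑ i, balTmul T R (x i) (y i) := by
  induction z using balTensor_induction with
  | tmul x' y =>
    obtain ⟨b, rfl⟩ := hx x'
    refine ⟨fun i => (b i).unop • y, ?_⟩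
    rw [sum_balTmul]
    exact Finset.sum_congr rfl fun i _ => op_smul_balTmul T R (b i).unop (x i) y
  | zero => exact ⟨0, by simp [balTmul_zero]⟩
  | add a b ha hb =>
    obtain ⟨y, rfl⟩ := ha
    obtain ⟨y', rfl⟩ := hb
    exact ⟨y + y', by simp [balTmul_add, Finset.sum_add_distrib]⟩

theorem balMap_sum_left {T T' : Type*} [Ring T] [Ring T'] {X X' N N' : Type u} [AddCommGroup X]
    [Module T X] [Module Rᵐᵒᵖ X] [SMulCommClass T Rᵐᵒᵖ X] [AddCommGroup X'] [Module T' X']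
    [Module Rᵐᵒᵖ X'] [SMulCommClass T' Rᵐᵒᵖ X'] [AddCommGroup N] [Module R N] [AddCommGroup N']
    [Module R N'] {ι : Type*} (s : Finset ι) (f : ι → (X →ₗ[Rᵐᵒᵖ] X')) (g : N →ₗ[R] N')
    (z : BalTensor T R X N) :
    balMap T T' R (∑ i ∈ s, f i) g z = ∑ i ∈ s, balMap T T' R (f i) g z := by
  induction z using balTensor_induction with
  | tmul x y => simp [sum_balTmul]
  | zero => simp
  | add a b ha hb => simp only [map_add, ha, hb, Finset.sum_add_distrib]

theorem balMap_leftMul {N : Type u} [AddCommGroup N] [Module R N] (t : S)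
    (z : BalTensor S R K N) : balMap S S R (leftMul S R K t) LinearMap.id z = t • z := by
  induction z using balTensor_induction with
  | tmul x y => rfl
  | zero => simp
  | add a b ha hb => simp only [smul_add, map_add, ha, hb]

variable {M Q : Type u} [AddCommGroup M] [Module R M] [AddCommGroup Q] [Module R Q]
  {N : Submodule R M} (hN : IsPureSubmodule N)

include hN

/-- Equations defined by a map of right modules and solvable in `M` are solvable in a pure
submodule. -/
theorem IsPureSubmodule.exists_preimage {E L : Type u} [AddCommGroup E] [Module Rᵐᵒᵖ E]
    [AddCommGroup L] [Module Rᵐᵒᵖ L] (δ : E →ₗ[Rᵐᵒᵖ] L) (w : BalTensor ℤ R E M)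
    (z : BalTensor ℤ R L N)
    (h : balMap ℤ ℤ R LinearMap.id N.subtype z = balMap ℤ ℤ R δ LinearMap.id w) :
    ∃ w' : BalTensor ℤ R E N, balMap ℤ ℤ R δ LinearMap.id w' = z := by
  have ex : Function.Exact δ (LinearMap.range δ).mkQ :=
    LinearMap.exact_iff.2 (by rw [Submodule.ker_mkQ])
  have hq := Submodule.mkQ_surjective (LinearMap.range δ)
  refine (balMap_exact_left ℤ ℤ ℤ R (N := N) ex hq z).1 ?_
  -- Purity is used at the cokernel of δ: vanishing of the image of `z` there can be checked after
  -- passing from N to M.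
  refine (injective_iff_map_eq_zero _).1
    (hN.injective_balMap ℤ ℤ R (X := L ⧸ LinearMap.range δ)) _ ?_
  have := (balMap_exact_left ℤ ℤ ℤ R (N := M) ex hq _).2 ⟨w, h.symm⟩
  rw [balMap_balMap] at this ⊢
  exact this

theorem IsPureSubmodule.balMapL_injective :
    Function.Injective (balMapL S R K N.subtype) := hN.injective_balMap S S R

variable {g : M →ₗ[R] Q} (ex : Function.Exact N.subtype g) (hg : Function.Surjective g)

include ex hg

/-- A finite S-linear system with unknowns in K ⊗ M is one equation in K^q ⊗ M, given by a map K^p →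
K^q of right R-modules. Purity of N over R therefore solves it in K ⊗ N. -/
theorem IsPureSubmodule.balMapL_liftsFinitelyPresented :
    LiftsFinitelyPresented (balMapL S R K g) := by
  refine liftsFinitelyPresented_of_solutions (f := balMapL S R K N.subtype)
    (balMap_exact_right S S S R ex hg) (balMap_surjective S S R Function.surjective_id hg) ?_
  intro p q s y z hz
  -- The matrix of the system acts on K^p by left multiplication, which commutes with the right
  -- R-action.
  let δ : (Fin p → K) →ₗ[Rᵐᵒᵖ] (Fin q → K) :=
    LinearMap.pi fun j => ∑ i, leftMul S R K (s j i) ∘ₗ LinearMap.proj i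
  let sp : ∀ (n : ℕ) (i : Fin n), K →ₗ[Rᵐᵒᵖ] (Fin n → K) := fun n i =>
    LinearMap.single Rᵐᵒᵖ (fun _ => K) i
  have hδ : ∀ i, δ ∘ₗ sp p i = ∑ j, sp q j ∘ₗ leftMul S R K (s j i) := fun i => by
    refine LinearMap.ext fun x => funext fun j => ?_
    simp only [δ, sp, LinearMap.comp_apply, LinearMap.pi_apply, LinearMap.sum_apply,
      LinearMap.proj_apply, LinearMap.single_apply, Finset.sum_apply]
    rw [Finset.sum_eq_single i (fun l _ hl => by rw [Pi.single_eq_of_ne hl, map_zero]) (by simp),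
      Finset.sum_eq_single j (fun l _ hl => by rw [Pi.single_eq_of_ne hl.symm]) (by simp),
      Pi.single_eq_same, Pi.single_eq_same]
  obtain ⟨w', hw'⟩ := hN.exists_preimage δ
    (∑ i, balMap S ℤ R (sp p i) LinearMap.id (y i))
    (∑ j, balMap S ℤ R (sp q j) LinearMap.id (z j)) (by
      simp only [map_sum, balMap_balMap, LinearMap.id_comp, LinearMap.comp_id, hδ,
        balMap_sum_left]
      rw [Finset.sum_comm]
      refine Finset.sum_congr rfl fun j _ => ?_
      have h1 := congrArg (balMap S ℤ R (sp q j) (LinearMap.id : M →ₗ[R] M)) (hz j)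
      change balMap S ℤ R (sp q j) LinearMap.id (balMap S S R LinearMap.id N.subtype (z j)) = _
        at h1
      rw [balMap_balMap] at h1
      refine h1.trans ?_
      rw [map_sum]
      refine Finset.sum_congr rfl fun i _ => ?_
      rw [← balMap_leftMul, balMap_balMap]
      rfl)
  refine ⟨fun i => balMap ℤ S R (LinearMap.proj i) LinearMap.id w', fun j => ?_⟩
  have h1 := congrArg (balMap ℤ S R (LinearMap.proj j) (LinearMap.id : N →ₗ[R] N)) hw'
  rw [balMap_balMap, map_sum] at h1
  rw [Finset.sum_eq_single j _ (by simp), balMap_balMap] at h1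
  · have h2 : (LinearMap.proj j : (Fin q → K) →ₗ[Rᵐᵒᵖ] K) ∘ₗ sp q j = LinearMap.id := by
      ext x
      simp [sp]
    rw [h2, LinearMap.id_comp, balMap_id] at h1
    have h3 : (LinearMap.proj j : (Fin q → K) →ₗ[Rᵐᵒᵖ] K) ∘ₗ δ =
        ∑ i, leftMul S R K (s j i) ∘ₗ LinearMap.proj i := LinearMap.proj_pi _ _
    rw [← h1, h3, balMap_sum_left]
    refine Finset.sum_congr rfl fun i _ => ?_
    rw [← balMap_leftMul, balMap_balMap]
    rfl
  · intro l _ hl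
    have h2 : (LinearMap.proj j : (Fin q → K) →ₗ[Rᵐᵒᵖ] K) ∘ₗ sp q l = 0 := by
      ext x
      simp [sp, hl.symm]
    rw [balMap_balMap, h2, balMap_zero_left]

end Purity

/-! ### Lifting along a pure epimorphism, from the case K = A. -/

section Purity

variable {A M : Type u} [Ring A] [AddCommGroup M] [Module A M]

variable (A M) in
/-- The isomorphism `A ⊗_A M → M`, as a linear map. -/
def selfBalTensorMap : BalTensor A A A M →ₗ[A] M where
  toFun := balLift A A (AddMonoidHom.mk' (fun a : A => AddMonoidHom.mk' (fun m : M => a • m)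
    (smul_add a)) (by intros; ext; simp [add_smul])) (by simp [mul_smul])
  map_add' := map_add _
  map_smul' s z := by
    induction z using balTensor_induction with
    | tmul x y => simp [smul_balTmul, mul_smul]
    | zero => simp
    | add a b ha hb => simp only [smul_add, map_add, ha, hb]

@[simp]
theorem selfBalTensorMap_tmul (a : A) (m : M) :
    selfBalTensorMap A M (balTmul A A a m) = a • m := rfl

variable (A M) in
/-- The inverse of `A ⊗_A M → M`. -/
def toSelfBalTensor : M →ₗ[A] BalTensor A A A M where
  toFun m := balTmul A A 1 m
  map_add' := balTmul_add A A 1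
  map_smul' a m := by
    rw [RingHom.id_apply, smul_balTmul, ← op_smul_balTmul]
    simp

theorem IsPureSubmodule.liftsFinitelyPresented {N : Submodule A M} (hN : IsPureSubmodule N)
    {Q : Type u} [AddCommGroup Q] [Module A Q] {g : M →ₗ[A] Q} (ex : Function.Exact N.subtype g)
    (hg : Function.Surjective g) : LiftsFinitelyPresented g := by
  intro V _ _ _ h
  obtain ⟨k, hk⟩ := hN.balMapL_liftsFinitelyPresented (S := A) (K := A) ex hg V
    (toSelfBalTensor A Q ∘ₗ h)
  refine ⟨selfBalTensorMap A M ∘ₗ k, LinearMap.ext fun v => ?_⟩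
  have h1 : ∀ z, g (selfBalTensorMap A M z) = selfBalTensorMap A Q (balMapL A A A g z) := by
    intro z
    induction z using balTensor_induction with
    | tmul x y => simp
    | zero => simp
    | add a b ha hb => simp only [map_add, ha, hb]
  have h2 := LinearMap.congr_fun hk v
  simp only [LinearMap.comp_apply] at h2 ⊢
  rw [h1, h2]
  simp [toSelfBalTensor]

end Purity

/-! ### Closure of `(n, d)`-injective modules -/

/-- Puts the bound, with n = ∞ allowed, in the form that `IsFinitelyNPresented.exists_syzygy`
requires. -/
theorem exists_add_two_add {n : ℕ∞} {d : ℕ} (hn : ((d + 1 : ℕ) : ℕ∞) < n) :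
    ∃ c : ℕ∞, n = c + 2 + d := by
  have h : ((d + 1 : ℕ) : ℕ∞) + 1 ≤ n := Order.add_one_le_of_lt hn
  obtain ⟨c, rfl⟩ := le_iff_exists_add.1 h
  refine ⟨c, ?_⟩
  push_cast
  rw [← one_add_one_eq_two]
  ring

section Injective

variable {A : Type u} [Ring A] {n : ℕ∞} {d : ℕ} {N M Q : Type u} [AddCommGroup N] [Module A N]
  [AddCommGroup M] [Module A M] [AddCommGroup Q] [Module A Q]

theorem IsNDInjective.congr (h : IsNDInjective A n d M) (e : M ≃ₗ[A] N) : IsNDInjective A n d N :=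
  fun U _ _ hU => ExtVanishes.congr_right (h U hU) e

theorem IsNDInjective.extVanishes (h : IsNDInjective A n d M) (U : Type u) [AddCommGroup U]
    [Module A U] (hU : IsFinitelyNPresented A ⊤ U) : ExtVanishes A (d + 1) U M :=
  h U (hU.mono le_top)

variable {f : N →ₗ[A] M} {g : M →ₗ[A] Q}

/-- A map from the finitely presented module ker π to Q lifts to M, extends there to the free
module, and is pushed down to Q again. -/
theorem IsNDInjective.of_liftsFinitelyPresented (hM : IsNDInjective A n d M)
    (hn : ((d + 1 : ℕ) : ℕ∞) < n) (hg : LiftsFinitelyPresented g) :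
    IsNDInjective A n d Q := by
  obtain ⟨c, rfl⟩ := exists_add_two_add hn
  intro U _ _ hU
  obtain ⟨V, _, _, m, π, hπ, -, hk, hT⟩ := hU.exists_syzygy
  refine (hT _ (isShiftFamily_ext Q)).2 ((extVanishes_one_iff hπ).2 fun φ => ?_)
  have hM' := (extVanishes_one_iff hπ).1 ((hT _ (isShiftFamily_ext M)).1 (hM U hU))
  obtain ⟨k, rfl⟩ := hg _ φ
  obtain ⟨ψ, rfl⟩ := hM' k
  exact ⟨g ∘ₗ ψ, rfl⟩

/-- A map ker π → N extends to the free module with values in M;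
`LiftsFinitelyPresented.exists_extension` corrects this to values in N. -/
theorem IsNDInjective.of_injective (hM : IsNDInjective A n d M)
    (hn : ((d + 1 : ℕ) : ℕ∞) < n) (hg : LiftsFinitelyPresented g) (hf : Function.Injective f)
    (ex : Function.Exact f g) : IsNDInjective A n d N := by
  obtain ⟨c, rfl⟩ := exists_add_two_add hn
  intro U _ _ hU
  obtain ⟨V, _, _, m, π, hπ, -, hk, hT⟩ := hU.exists_syzygy
  refine (hT _ (isShiftFamily_ext N)).2 ((extVanishes_one_iff hπ).2 fun φ => ?_)
  have hM' := (extVanishes_one_iff hπ).1 ((hT _ (isShiftFamily_ext M)).1 (hM U hU))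
  obtain ⟨ψ, hψ⟩ := hM' (f ∘ₗ φ)
  exact hg.exists_extension hf ex (LinearMap.ker π).subtype ψ φ hψ.symm

end Injective

/-! ### The natural maps -/

section Natural

variable (S R K : Type u) [Ring S] [Ring R] [AddCommGroup K] [Module S K] [Module Rᵐᵒᵖ K]
  [SMulCommClass S Rᵐᵒᵖ K]

/-- A homomorphism as an element of the left `R`-module `Hom_S(K, I)`. -/
def BimodHom.of {I : Type u} [AddCommGroup I] [Module S I] : (K →ₗ[S] I) ≃+ BimodHom S R K I :=
  AddEquiv.refl _

variable {S R K} in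
/-- An element of `Hom_S(K, I)` as a linear map. -/
def BimodHom.hom {I : Type u} [AddCommGroup I] [Module S I] (φ : BimodHom S R K I) : K →ₗ[S] I := φ

@[simp]
theorem BimodHom.hom_of {I : Type u} [AddCommGroup I] [Module S I] (φ : K →ₗ[S] I) :
    (BimodHom.of S R K φ).hom = φ := rfl

@[ext]
theorem BimodHom.ext {I : Type u} [AddCommGroup I] [Module S I] {φ ψ : BimodHom S R K I}
    (h : ∀ x, φ.hom x = ψ.hom x) : φ = ψ := LinearMap.ext h

@[simp]
theorem BimodHom.hom_add {I : Type u} [AddCommGroup I] [Module S I] (φ ψ : BimodHom S R K I) :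
    (φ + ψ).hom = φ.hom + ψ.hom := rfl

@[simp]
theorem BimodHom.hom_zero {I : Type u} [AddCommGroup I] [Module S I] :
    (0 : BimodHom S R K I).hom = 0 := rfl

theorem BimodHom.hom_sum {I : Type u} [AddCommGroup I] [Module S I] {ι : Type*} (s : Finset ι)
    (φ : ι → BimodHom S R K I) : (∑ i ∈ s, φ i).hom = ∑ i ∈ s, (φ i).hom :=
  map_sum (BimodHom.of S R K (I := I)).symm φ s

@[simp]
theorem BimodHom.smul_hom_apply {I : Type u} [AddCommGroup I] [Module S I] (r : R)
    (φ : BimodHom S R K I) (x : K) : (r • φ).hom x = φ.hom (MulOpposite.op r • x) := rfl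

/-- The natural map `M → Hom_S(K, K ⊗_R M)`. -/
def unitMap (M : Type u) [AddCommGroup M] [Module R M] :
    M →ₗ[R] BimodHom S R K (BalTensor S R K M) where
  toFun m := BimodHom.of S R K
    { toFun := fun x => balTmul S R x m
      map_add' := fun x y => add_balTmul S R x y m
      map_smul' := fun _ _ => rfl }
  map_add' m m' := BimodHom.ext S R K fun x => balTmul_add S R x m m'
  map_smul' r m := BimodHom.ext S R K fun x => (op_smul_balTmul S R r x m).symm

@[simp]
theorem unitMap_hom_apply (M : Type u) [AddCommGroup M] [Module R M] (m : M) (x : K) :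
    (unitMap S R K M m).hom x = balTmul S R x m := rfl

/-- The natural map `K ⊗_R Hom_S(K, I) → I`. -/
def counitMap (I : Type u) [AddCommGroup I] [Module S I] :
    BalTensor S R K (BimodHom S R K I) →ₗ[S] I where
  toFun := balLift S R (AddMonoidHom.mk' (fun x => AddMonoidHom.mk'
    (fun φ : BimodHom S R K I => φ.hom x) (by simp))
    (fun x y => AddMonoidHom.ext fun φ : BimodHom S R K I => map_add φ.hom x y))
    fun _ _ _ => rfl
  map_add' := map_add _
  map_smul' s z := by
    induction z using balTensor_induction with
    | tmul x y => exact y.hom.map_smul s x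
    | zero => simp
    | add a b ha hb => simp only [smul_add, map_add, ha, hb]

@[simp]
theorem counitMap_tmul (I : Type u) [AddCommGroup I] [Module S I] (x : K)
    (φ : BimodHom S R K I) : counitMap S R K I (balTmul S R x φ) = φ.hom x := rfl

end Natural

/-! ### Modules of the form `Hom_S(K, I)` -/

section RelInjective

variable {S R K : Type u} [Ring S] [Ring R] [AddCommGroup K] [Module S K] [Module Rᵐᵒᵖ K]
  [SMulCommClass S Rᵐᵒᵖ K] {n : ℕ∞} {d : ℕ}

/-- `exists_coresolution` with A = S and B = R^op presents I by powers of Hom_S(K, I), using the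
relations that present K over R; the same relations present K ⊗ Hom_S(K, I). -/
theorem IsSpecialSemidualizing.counitMap_bijective {C : Type u} [AddCommGroup C] [Module S C]
    [Module Rᵐᵒᵖ C] [SMulCommClass S Rᵐᵒᵖ C] (hK : IsSpecialSemidualizing S R d K C)
    {I : Type u} [AddCommGroup I] [Module S I] (hI : IsNDInjective S n d I) :
    Function.Bijective (counitMap S R K I) := by
  have := SMulCommClass.symm S Rᵐᵒᵖ K
  obtain ⟨m₀, m₁, k, a, hk, ha, h1, h2⟩ := exists_coresolution (A := S) (B := Rᵐᵒᵖ) (K := K)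
    (I := I)
    hK.syzygy_left.isFinitelyNPresented hK.syzygy_right.isFinitelyNPresented
    (fun i => hK.semidualizing.ext_right (i + 1) (by omega)) hK.semidualizing.homothety_left
    (hK.syzygy_left.extVanishes hI.extVanishes) hI.extVanishes
  constructor
  · rw [injective_iff_map_eq_zero]
    intro z hz
    obtain ⟨φ, rfl⟩ := exists_eq_sum_balTmul (T := S) hk z
    simp only [map_sum, counitMap_tmul] at hz
    obtain ⟨ψ, hψ⟩ := h2 (fun i => (φ i).hom) hz
    have hφ : ∀ i, φ i = ∑ j, (a j i).unop • BimodHom.of S R K (ψ j) := fun i => by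
      ext x
      rw [BimodHom.hom_sum, LinearMap.sum_apply]
      exact hψ i x
    -- Moving the coefficients `a j i` to the left produces the relations ∑ᵢ a j i • k i = 0.
    simp only [hφ, balTmul_sum, ← op_smul_balTmul, MulOpposite.op_unop]
    rw [Finset.sum_comm]
    simp only [← sum_balTmul, ha, zero_balTmul, Finset.sum_const_zero]
  · intro x
    obtain ⟨φ, rfl⟩ := h1 x
    exact ⟨∑ i, balTmul S R (k i) (BimodHom.of S R K (φ i)), by simp⟩

variable {M : Type u} [AddCommGroup M] [Module R M]

/-- If M ≅ Hom_S(K, I), the counit gives K ⊗ M ≅ I, and the unit of M is then bijective by the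
triangle identity. The auxiliary I disappears, leaving conditions on M that can be compared along a
pure sequence. -/
theorem IsRelNDInjective.exists_counit (hM : IsRelNDInjective S R K n d M)
    (hK : ∀ (I : Type u) [AddCommGroup I] [Module S I], IsNDInjective S n d I →
      Function.Bijective (counitMap S R K I)) :
    Function.Bijective (unitMap S R K M) ∧ IsNDInjective S n d (BalTensor S R K M) := by
  obtain ⟨I, _, _, hI, ⟨e⟩⟩ := hM
  let ε : BalTensor S R K M →ₗ[S] I := counitMap S R K I ∘ₗ balMapL S R K e.toLinearMap
  have hε : Function.Bijective ε :=
    (hK I hI).comp (balMap_bijective_of_equiv S S R (.refl Rᵐᵒᵖ K) e)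
  have hε' : ∀ x m, ε (balTmul S R x m) = (e m).hom x := fun _ _ => rfl
  refine ⟨⟨?_, fun θ => ?_⟩, hI.congr (LinearEquiv.ofBijective ε hε).symm⟩
  · rw [injective_iff_map_eq_zero]
    intro m hm
    rw [← e.map_eq_zero_iff]
    ext x
    rw [← hε', ← unitMap_hom_apply, hm]
    simp
  · refine ⟨e.symm (BimodHom.of S R K (ε ∘ₗ θ.hom)), BimodHom.ext S R K fun x => hε.1 ?_⟩
    rw [unitMap_hom_apply, hε', e.apply_symm_apply]
    rfl

theorem isRelNDInjective_of_unitMap (h : Function.Bijective (unitMap S R K M))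
    (h' : IsNDInjective S n d (BalTensor S R K M)) : IsRelNDInjective S R K n d M :=
  ⟨_, _, _, h', ⟨LinearEquiv.ofBijective _ h⟩⟩

variable {N : Submodule R M} {Q : Type u} [AddCommGroup Q] [Module R Q] {g : M →ₗ[R] Q}

/-- With S-generators kᵢ of K, a map θ : K → K ⊗ N comes from y ∈ N when kᵢ ⊗ y = θ(kᵢ) for all i.
This finite system is solvable in M since the unit of M is onto, hence in N by purity. -/
theorem IsPureSubmodule.unitMap_bijective (hN : IsPureSubmodule N) [Module.Finite S K]
    (h : Function.Bijective (unitMap S R K M)) : Function.Bijective (unitMap S R K N) := by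
  constructor
  · rw [injective_iff_map_eq_zero]
    intro m hm
    refine Subtype.ext (h.1 ?_)
    ext x
    have := congrArg (balMapL S R K N.subtype) (congrArg (fun θ => θ.hom x) hm)
    simpa [balTmul_zero] using this
  · intro θ
    obtain ⟨r, k, hk⟩ := Submodule.fg_iff_exists_fin_generating_family.1
      (Module.Finite.fg_top (R := S) (M := K))
    obtain ⟨m, hm⟩ := h.2 (BimodHom.of S R K (balMapL S R K N.subtype ∘ₗ θ.hom))
    have hm' : ∀ x, balTmul S R x m = balMapL S R K N.subtype (θ.hom x) := fun x =>
      congrArg (fun θ => θ.hom x) hm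
    -- Tensored with N, this map sends 1 ⊗ y to the tuple (kᵢ ⊗ y).
    let δ : R →ₗ[Rᵐᵒᵖ] (Fin r → K) :=
      { toFun := fun a i => MulOpposite.op a • k i
        map_add' := fun a b => funext fun i => by simp [add_smul]
        map_smul' := fun a b => funext fun i => by simp [mul_smul] }
    let sp : Fin r → (K →ₗ[Rᵐᵒᵖ] (Fin r → K)) := fun i => LinearMap.single Rᵐᵒᵖ (fun _ => K) i
    obtain ⟨w, hw⟩ := hN.exists_preimage δ (balTmul ℤ R 1 m)
      (∑ i, balMap S ℤ R (sp i) LinearMap.id (θ.hom (k i))) (by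
        rw [map_sum, balMap_tmul]
        simp only [balMap_balMap, LinearMap.id_comp, LinearMap.comp_id]
        have h1 : ∀ i, balMap S ℤ R (sp i) N.subtype (θ.hom (k i)) =
            balTmul ℤ R (sp i (k i)) m := fun i => by
          have := congrArg (balMap S ℤ R (sp i) LinearMap.id) (hm' (k i))
          rw [balMap_tmul] at this
          refine .trans ?_ this.symm
          change _ = balMap S ℤ R (sp i) LinearMap.id (balMap S S R LinearMap.id N.subtype _)
          rw [balMap_balMap]
          rfl
        simp only [h1]
        rw [← sum_balTmul]
        congr 1
        refine (LinearMap.sum_single_apply (fun _ => K) k).trans ?_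
        ext i
        simp [δ])
    obtain ⟨y, hy⟩ := exists_eq_sum_balTmul (T := ℤ) (m := 1) (x := fun _ => (1 : R))
      (fun y => ⟨fun _ => MulOpposite.op y, by simp⟩) w
    obtain rfl : w = balTmul ℤ R 1 (y 0) := by simpa using hy
    refine ⟨y 0, BimodHom.ext S R K fun x => ?_⟩
    have key : ∀ i, balTmul S R (k i) (y 0) = θ.hom (k i) := fun i => by
      have h1 := congrArg (balMap ℤ S R (LinearMap.proj i) (LinearMap.id : N →ₗ[R] N)) hw
      rw [balMap_tmul, map_sum, Finset.sum_eq_single i _ (by simp), balMap_balMap] at h1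
      · have h2 : (LinearMap.proj i : (Fin r → K) →ₗ[Rᵐᵒᵖ] K) ∘ₗ sp i = LinearMap.id := by
          ext x
          simp [sp]
        rw [h2, LinearMap.id_comp, balMap_id, balMap_tmul] at h1
        simpa [δ] using h1
      · intro l _ hl
        have h2 : (LinearMap.proj i : (Fin r → K) →ₗ[Rᵐᵒᵖ] K) ∘ₗ sp l = 0 := by
          ext x
          simp [sp, hl.symm]
        rw [balMap_balMap, h2, balMap_zero_left]
    have : (unitMap S R K N (y 0)).hom = θ.hom := by
      refine LinearMap.ext_on_range hk fun i => ?_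
      exact key i
    rw [this]

/-- Hom_S(K, K ⊗ -) keeps the sequence exact: on the left because K ⊗ N → K ⊗ M is injective, on the
right because K is finitely presented. The units of N and M then determine that of Q. -/
theorem IsPureSubmodule.unitMap_quotient_bijective (hN : IsPureSubmodule N)
    [Module.FinitePresentation S K] (h : Function.Bijective (unitMap S R K M))
    (ex : Function.Exact N.subtype g) (hg : Function.Surjective g) :
    Function.Bijective (unitMap S R K Q) := by
  have hnat : ∀ m x, balTmul S R x (g m) = balMapL S R K g ((unitMap S R K M m).hom x) :=
    fun _ _ => rfl
  constructor
  · rw [injective_iff_map_eq_zero]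
    intro q hq
    obtain ⟨m, rfl⟩ := hg q
    obtain ⟨θ, hθ⟩ := Function.Exact.exists_lift (f := balMapL S R K N.subtype)
      (g := balMapL S R K g) (balMap_exact_right S S S R ex hg) hN.balMapL_injective
      (unitMap S R K M m).hom (LinearMap.ext fun x => congrArg (fun θ => θ.hom x) hq)
    obtain ⟨m', hm'⟩ := (hN.unitMap_bijective h).2 (BimodHom.of S R K θ)
    have : m = m' := h.1 <| BimodHom.ext S R K fun x => by
      rw [← LinearMap.congr_fun hθ x]
      exact congrArg (balMapL S R K N.subtype) (congrArg (fun θ => θ.hom x) hm').symm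
    rw [this]
    exact ex.apply_apply_eq_zero m'
  · intro θ
    obtain ⟨θ', hθ'⟩ := hN.balMapL_liftsFinitelyPresented ex hg K θ.hom
    obtain ⟨m, hm⟩ := h.2 (BimodHom.of S R K θ')
    refine ⟨g m, BimodHom.ext S R K fun x => ?_⟩
    rw [unitMap_hom_apply, hnat, hm]
    exact LinearMap.congr_fun hθ' x

end RelInjective

/-! ### Closure of `(n, d)`-flat modules -/

section Flat

variable {R : Type u} [Ring R] {n : ℕ∞} {d : ℕ} {N M Q : Type u} [AddCommGroup N] [Module R N]
  [AddCommGroup M] [Module R M] [AddCommGroup Q] [Module R Q]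

/-- Transport goes through the description of Tor_1 as an injectivity statement, where functoriality
in the left module is visible. -/
theorem IsNDFlat.congr (h : IsNDFlat R n d M) (hn : ((d + 1 : ℕ) : ℕ∞) < n) (e : M ≃ₗ[R] N) :
    IsNDFlat R n d N := by
  obtain ⟨c, rfl⟩ := exists_add_two_add hn
  intro U _ _ hU
  obtain ⟨V, _, _, m, π, hπ, -, hk, hT⟩ := hU.exists_syzygy
  refine (hT _ (isShiftFamily_torR N)).2 ((subsingleton_torR_one_iff N π hπ).2 ?_)
  have hM := (subsingleton_torR_one_iff M π hπ).1 ((hT _ (isShiftFamily_torR M)).1 (h U hU))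
  have he := balMap_bijective_of_equiv ℤ ℤ R (.refl Rᵐᵒᵖ (LinearMap.ker π)) e
  have he' := balMap_bijective_of_equiv ℤ ℤ R (.refl Rᵐᵒᵖ (Fin m → Rᵐᵒᵖ)) e
  rw [← Function.Injective.of_comp_iff' _ he]
  convert he'.1.comp hM using 1
  funext z
  simp only [Function.comp_apply, balMap_balMap]
  rfl

variable {f : N →ₗ[R] M} {g : M →ₗ[R] Q}

/-- `X ⊗ f` is injective for every finitely presented right module `X`. -/
def IsInjectiveOnFinitelyPresented (f : N →ₗ[R] M) : Prop :=
  ∀ (X : Type u) [AddCommGroup X] [Module Rᵐᵒᵖ X] [Module.FinitePresentation Rᵐᵒᵖ X],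
    Function.Injective (balMap ℤ ℤ R (LinearMap.id : X →ₗ[Rᵐᵒᵖ] X) f)

/-- ker π ⊗ N embeds in ker π ⊗ M, as ker π is finitely presented, and from there into the free
module tensored with M. -/
theorem IsNDFlat.of_injective (hM : IsNDFlat R n d M) (hn : ((d + 1 : ℕ) : ℕ∞) < n)
    (hf : IsInjectiveOnFinitelyPresented f) : IsNDFlat R n d N := by
  obtain ⟨c, rfl⟩ := exists_add_two_add hn
  intro U _ _ hU
  obtain ⟨V, _, _, m, π, hπ, -, hk, hT⟩ := hU.exists_syzygy
  refine (hT _ (isShiftFamily_torR N)).2 ((subsingleton_torR_one_iff N π hπ).2 ?_)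
  have hM' := (subsingleton_torR_one_iff M π hπ).1 ((hT _ (isShiftFamily_torR M)).1 (hM U hU))
  refine Function.Injective.of_comp (f := balMap ℤ ℤ R LinearMap.id f) ?_
  convert hM'.comp (hf _) using 1
  funext z
  simp only [Function.comp_apply, balMap_balMap]
  rfl

/-- The chase behind Tor_1(V, M) → Tor_1(V, Q) → V ⊗ N → V ⊗ M: the first term vanishes, and the
last map is injective because V is finitely presented. -/
theorem IsNDFlat.of_surjective (hM : IsNDFlat R n d M) (hn : ((d + 1 : ℕ) : ℕ∞) < n)
    (hf : IsInjectiveOnFinitelyPresented f) (ex : Function.Exact f g)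
    (hg : Function.Surjective g) : IsNDFlat R n d Q := by
  obtain ⟨c, rfl⟩ := exists_add_two_add hn
  intro U _ _ hU
  obtain ⟨V, _, _, m, π, hπ, hV, hk, hT⟩ := hU.exists_syzygy
  refine (hT _ (isShiftFamily_torR Q)).2 ((subsingleton_torR_one_iff Q π hπ).2 ?_)
  have hM' := (subsingleton_torR_one_iff M π hπ).1 ((hT _ (isShiftFamily_torR M)).1 (hM U hU))
  rw [injective_iff_map_eq_zero]
  intro z hz
  obtain ⟨w, rfl⟩ := balMap_surjective ℤ ℤ R
    (f := (LinearMap.id : LinearMap.ker π →ₗ[Rᵐᵒᵖ] LinearMap.ker π)) Function.surjective_id hg z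
  rw [balMap_balMap, LinearMap.id_comp, LinearMap.comp_id] at hz
  obtain ⟨y, hy⟩ := (balMap_exact_right ℤ ℤ ℤ R (X := Fin m → Rᵐᵒᵖ) ex hg
    (balMap ℤ ℤ R (LinearMap.ker π).subtype LinearMap.id w)).1 (by rw [balMap_balMap]; exact hz)
  have hex := LinearMap.exact_subtype_ker_map π
  obtain ⟨x, rfl⟩ := (balMap_exact_left ℤ ℤ ℤ R (N := N) hex hπ y).1 (by
    refine (injective_iff_map_eq_zero _).1 (hf V) _ ?_
    have h1 := congrArg (balMap ℤ ℤ R π (LinearMap.id : M →ₗ[R] M)) hy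
    rw [(balMap_exact_left ℤ ℤ ℤ R hex hπ).apply_apply_eq_zero, balMap_balMap] at h1
    rw [balMap_balMap]
    exact h1)
  obtain rfl : balMap ℤ ℤ R LinearMap.id f x = w := hM' (by
    rw [← hy, balMap_balMap, balMap_balMap]
    rfl)
  exact (balMap_exact_right ℤ ℤ ℤ R ex hg).apply_apply_eq_zero x

/-- The character module of an `(n, d)`-flat module is `(∞, d)`-injective. -/
theorem IsNDFlat.extVanishes_rightDual (h : IsNDFlat R n d M) (U : Type u) [AddCommGroup U]
    [Module Rᵐᵒᵖ U] (hU : IsFinitelyNPresented Rᵐᵒᵖ ⊤ U) :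
    ExtVanishes Rᵐᵒᵖ (d + 1) U (RightDual M) := by
  have hU' : IsFinitelyNPresented Rᵐᵒᵖ (⊤ + 2 + d) U := hU.mono le_top
  obtain ⟨V, _, _, m, π, hπ, -, -, hT⟩ := hU'.exists_syzygy
  refine (hT _ (isShiftFamily_ext (RightDual M))).2 ((extVanishes_one_iff hπ).2 fun φ => ?_)
  have hM := (subsingleton_torR_one_iff M π hπ).1
    ((hT _ (isShiftFamily_torR M)).1 (h U (hU.mono le_top)))
  -- A map ker π → M⁺ is a character of ker π ⊗ M, and it extends to the larger tensor product
  -- because ℚ/ℤ is injective.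
  obtain ⟨χ, hχ⟩ := exists_character_extension _ hM (ofRightDual ℤ φ)
  refine ⟨toRightDual R M ℤ χ, LinearMap.ext fun x => AddMonoidHom.ext fun y => ?_⟩
  exact hχ (balTmul ℤ R x y)

end Flat

/-! ### Modules of the form `K ⊗_R F` -/

section RelFlat

variable {S R K : Type u} [Ring S] [Ring R] [AddCommGroup K] [Module S K] [Module Rᵐᵒᵖ K]
  [SMulCommClass S Rᵐᵒᵖ K] {n : ℕ∞} {d : ℕ}

/-- `exists_coresolution` with A = R^op, B = S and I = F⁺ gives exactness of the character dual of 0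
→ F → (K ⊗ F)^{m₀} → (K ⊗ F)^{m₁}. Characters detect exactness, and the kernel of the last map is
Hom_S(K, K ⊗ F). -/
theorem IsSpecialSemidualizing.unitMap_bijective {C : Type u} [AddCommGroup C] [Module S C]
    [Module Rᵐᵒᵖ C] [SMulCommClass S Rᵐᵒᵖ C] (hK : IsSpecialSemidualizing S R d K C)
    {F : Type u} [AddCommGroup F] [Module R F] (hF : IsNDFlat R n d F) :
    Function.Bijective (unitMap S R K F) := by
  have := SMulCommClass.symm S Rᵐᵒᵖ K
  have hhom : Function.Bijective
      (LinearMap.toSpanSingleton Rᵐᵒᵖ (K →ₗ[S] K) (LinearMap.id : K →ₗ[S] K)) :=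
    hK.semidualizing.homothety_right.comp MulOpposite.opEquiv.symm.bijective
  obtain ⟨m₀, m₁, k, a, hk, ha, h1, h2⟩ := exists_coresolution (A := Rᵐᵒᵖ) (B := S) (K := K)
    (I := RightDual F)
    hK.syzygy_right.isFinitelyNPresented hK.syzygy_left.isFinitelyNPresented
    (fun i => hK.semidualizing.ext_left (i + 1) (by omega)) hhom
    (hK.syzygy_right.extVanishes hF.extVanishes_rightDual) hF.extVanishes_rightDual
  constructor
  · rw [injective_iff_map_eq_zero]
    intro y hy
    refine eq_zero_of_forall_character fun χ => ?_
    -- Every character of F is y ↦ ∑ᵢ φᵢ(kᵢ ⊗ y) for characters φᵢ of K ⊗ F, so it kills the kernel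
    -- of the unit.
    obtain ⟨φ, hφ⟩ := h1 (show RightDual F from χ)
    have h3 := congrArg (fun c : RightDual F => c.eval y) hφ
    refine h3.symm.trans ((RightDual.sum_eval _ _ y).trans (Finset.sum_eq_zero fun i _ => ?_))
    have h4 := congrArg (fun θ => ofRightDual S (φ i) (θ.hom (k i))) hy
    simpa using h4
  · intro θ
    let H : AddSubgroup (Fin m₀ → BalTensor S R K F) :=
      (AddMonoidHom.mk' (fun (y : F) i => balTmul S R (k i) y)
        fun y y' => funext fun i => balTmul_add S R (k i) y y').range
    by_cases hH : (fun i => θ.hom (k i)) ∈ H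
    · obtain ⟨y, hy⟩ := hH
      refine ⟨y, BimodHom.ext S R K fun x => ?_⟩
      obtain ⟨b, rfl⟩ := hk x
      simp only [map_sum, map_smul]
      exact Finset.sum_congr rfl fun i _ => congrArg (b i • ·) (congrFun hy i)
    · exfalso
      -- A character killing the image of F is by `h2` a combination of the relations of K over S;
      -- these hold for the values θ(kᵢ) since θ is S-linear, so the character also kills the tuple
      -- of values.
      obtain ⟨χ, hχ, hχ'⟩ := exists_character_of_notMem H hH
      let χc : Fin m₀ → (BalTensor S R K F →+ AddCircle (1 : ℚ)) := fun i =>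
        χ.comp (AddMonoidHom.single (fun _ : Fin m₀ => BalTensor S R K F) i)
      have hχc : ∀ z, χ z = ∑ i, χc i (z i) := fun z => by
        conv_lhs => rw [← Finset.univ_sum_single z]
        rw [map_sum]
        rfl
      obtain ⟨ψ, hψ⟩ := h2 (fun i => toRightDual R F S (χc i)) (by
        refine AddMonoidHom.ext fun y => ?_
        refine (RightDual.sum_eval _ _ y).trans ?_
        refine .trans ?_ (hχ _ ⟨y, rfl⟩)
        rw [hχc]
        rfl)
      have h3 : ∀ i z, χc i z = ∑ j, ofRightDual S (ψ j) (a j i • z) := fun i z => by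
        induction z using balTensor_induction with
        | tmul x y =>
          have h4 := congrArg (fun c : RightDual F => c.eval y) (hψ i x)
          exact h4.trans (RightDual.sum_eval _ _ y)
        | zero => simp
        | add z z' hz hz' => simp only [map_add, smul_add, hz, hz', Finset.sum_add_distrib]
      refine hχ' ?_
      simp only [hχc, h3]
      rw [Finset.sum_comm]
      refine Finset.sum_eq_zero fun j _ => ?_
      rw [← map_sum]
      simp only [← map_smul]
      rw [← map_sum, ha, map_zero, map_zero]

variable {M N Q : Type u} [AddCommGroup M] [Module S M] [AddCommGroup N] [Module S N]
  [AddCommGroup Q] [Module S Q]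

/-- Dual to `IsRelNDInjective.exists_counit`: if M ≅ K ⊗ F, the unit gives F ≅ Hom_S(K, M), and the
triangle identity makes the counit of M bijective. -/
theorem IsRelNDFlat.exists_unit (hM : IsRelNDFlat S R K n d M) (hn : ((d + 1 : ℕ) : ℕ∞) < n)
    (hK : ∀ (F : Type u) [AddCommGroup F] [Module R F], IsNDFlat R n d F →
      Function.Bijective (unitMap S R K F)) :
    Function.Bijective (counitMap S R K M) ∧ IsNDFlat R n d (BimodHom S R K M) := by
  obtain ⟨F, _, _, hF, ⟨e⟩⟩ := hM
  let ε : F →ₗ[R] BimodHom S R K M :=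
    { toFun := fun y => BimodHom.of S R K (e.symm.toLinearMap ∘ₗ (unitMap S R K F y).hom)
      map_add' := fun y y' => BimodHom.ext S R K fun x => by simp
      map_smul' := fun r y => BimodHom.ext S R K fun x =>
        congrArg e.symm (op_smul_balTmul S R r x y).symm }
  have hε' : ∀ y x, (ε y).hom x = e.symm (balTmul S R x y) := fun _ _ => rfl
  have hε : Function.Bijective ε := by
    constructor
    · rw [injective_iff_map_eq_zero]
      intro y hy
      refine (injective_iff_map_eq_zero _).1 (hK F hF).1 y (BimodHom.ext S R K fun x => ?_)
      have := congrArg (fun θ => θ.hom x) hy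
      simpa [hε'] using this
    · intro θ
      obtain ⟨y, hy⟩ := (hK F hF).2 (BimodHom.of S R K (e.toLinearMap ∘ₗ θ.hom))
      refine ⟨y, BimodHom.ext S R K fun x => ?_⟩
      have := congrArg (fun θ => θ.hom x) hy
      rw [hε', e.symm_apply_eq]
      exact this
  let E := LinearEquiv.ofBijective ε hε
  refine ⟨?_, hF.congr hn E⟩
  have hb := balMap_bijective_of_equiv S S R (.refl Rᵐᵒᵖ K) E
  rw [← Function.Bijective.of_comp_iff _ hb]
  convert e.symm.bijective using 1
  funext z
  induction z using balTensor_induction with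
  | tmul x y => rfl
  | zero => simp
  | add a b ha hb => rw [map_add e.symm, ← ha, ← hb]; simp

theorem isRelNDFlat_of_counitMap (h : Function.Bijective (counitMap S R K M))
    (h' : IsNDFlat R n d (BimodHom S R K M)) : IsRelNDFlat S R K n d M :=
  ⟨_, _, _, h', ⟨(LinearEquiv.ofBijective _ h).symm⟩⟩

variable (R K) in
/-- Composition with `f`, as a map `Hom_S(K, N) → Hom_S(K, M)`. -/
def bimodHomMap (f : N →ₗ[S] M) : BimodHom S R K N →ₗ[R] BimodHom S R K M where
  toFun φ := BimodHom.of S R K (f ∘ₗ φ.hom)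
  map_add' φ ψ := BimodHom.ext S R K fun x => by simp
  map_smul' r φ := BimodHom.ext S R K fun x => rfl

@[simp]
theorem bimodHomMap_hom_apply (f : N →ₗ[S] M) (φ : BimodHom S R K N) (x : K) :
    (bimodHomMap R K f φ).hom x = f (φ.hom x) := rfl

theorem counitMap_naturality (f : N →ₗ[S] M) (z : BalTensor S R K (BimodHom S R K N)) :
    counitMap S R K M (balMapL S R K (bimodHomMap R K f) z) = f (counitMap S R K N z) := by
  induction z using balTensor_induction with
  | tmul x y => rfl
  | zero => simp
  | add a b ha hb => simp only [map_add, ha, hb]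

variable {f : N →ₗ[S] M} {g : M →ₗ[S] Q}

theorem bimodHomMap_exact (hf : Function.Injective f) (ex : Function.Exact f g) :
    Function.Exact (bimodHomMap R K f) (bimodHomMap R K g) := by
  intro φ
  constructor
  · intro h
    obtain ⟨ψ, hψ⟩ := ex.exists_lift hf φ.hom
      (LinearMap.ext fun x => congrArg (fun θ => θ.hom x) h)
    exact ⟨BimodHom.of S R K ψ, BimodHom.ext S R K fun x => LinearMap.congr_fun hψ x⟩
  · rintro ⟨ψ, rfl⟩
    exact BimodHom.ext S R K fun x => ex.apply_apply_eq_zero _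

theorem bimodHomMap_surjective [Module.FinitePresentation S K] (hg : LiftsFinitelyPresented g) :
    Function.Surjective (bimodHomMap R K g) := fun φ => by
  obtain ⟨ψ, hψ⟩ := hg K φ.hom
  exact ⟨BimodHom.of S R K ψ, BimodHom.ext S R K fun x => LinearMap.congr_fun hψ x⟩

/-- An element ∑ xᵢ ⊗ ψᵢ dies in X ⊗ Hom_S(K, M) when the tuple (f ψᵢ) factors through the map K^p →
K^q given by the relations of X. By `LiftsFinitelyPresented.exists_extension` the tuple (ψᵢ) then
factors through it already in N. -/
theorem isInjectiveOnFinitelyPresented_bimodHomMap [Module.FinitePresentation S K]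
    (hg : LiftsFinitelyPresented g) (hf : Function.Injective f) (ex : Function.Exact f g) :
    IsInjectiveOnFinitelyPresented (bimodHomMap R K f) := by
  intro X _ _ _
  obtain ⟨p, q, ρ, γ, hρ, hγ⟩ := Module.FinitePresentation.exists_fin' Rᵐᵒᵖ X
  rw [injective_iff_map_eq_zero]
  intro z hz
  have hgen : ∀ (m : ℕ) (b : Fin m → Rᵐᵒᵖ),
      b = ∑ i, b i • (Pi.single i (1 : Rᵐᵒᵖ) : Fin m → Rᵐᵒᵖ) := fun m b => by
    conv_lhs => rw [← Finset.univ_sum_single b]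
    exact Finset.sum_congr rfl fun i _ => by rw [← Pi.single_smul, smul_eq_mul, mul_one]
  obtain ⟨ψ, rfl⟩ := exists_eq_sum_balTmul (T := ℤ) (x := fun i => ρ (Pi.single i 1))
    (fun x => by
      obtain ⟨b, rfl⟩ := hρ x
      refine ⟨b, ?_⟩
      conv_lhs => rw [hgen p b]
      simp) z
  obtain ⟨w, hw⟩ := (balMap_exact_left ℤ ℤ ℤ R (N := BimodHom S R K M) hγ hρ
    (∑ i, balTmul ℤ R (Pi.single i 1) (bimodHomMap R K f (ψ i)))).1 (by
      rw [← hz]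
      simp)
  obtain ⟨ξ, rfl⟩ := exists_eq_sum_balTmul (T := ℤ)
    (x := fun j => (Pi.single j (1 : Rᵐᵒᵖ) : Fin q → Rᵐᵒᵖ)) (fun b => ⟨b, hgen q b⟩) w
  let r : Fin p → Fin q → R := fun i j => (γ (Pi.single j 1) i).unop
  have hξ : ∀ i, bimodHomMap R K f (ψ i) = ∑ j, r i j • ξ j := fun i => by
    -- The ith coordinate of R^p ⊗ Hom_S(K, M) ≅ Hom_S(K, M)^p.
    let ev : BalTensor ℤ R (Fin p → Rᵐᵒᵖ) (BimodHom S R K M) →+ BimodHom S R K M :=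
      balLift ℤ R (AddMonoidHom.mk' (fun b => AddMonoidHom.mk' (fun y => (b i).unop • y)
        (smul_add _)) (by intros; ext y; simp [add_smul])) (by simp [mul_smul])
    have hev : ∀ b y, ev (balTmul ℤ R b y) = (b i).unop • y := fun _ _ => rfl
    have h1 := congrArg ev hw
    simp only [map_sum, balMap_tmul, hev] at h1
    rw [Finset.sum_eq_single i (fun l _ hl => by simp [hl.symm]) (by simp)] at h1
    simpa [r] using h1.symm
  let α : (Fin p → K) →ₗ[S] (Fin q → K) :=
    LinearMap.pi fun j => ∑ i, rightMul S R K (r i j) ∘ₗ LinearMap.proj i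
  have hα : ∀ i x, α (Pi.single i x) = ∑ j, Pi.single j (MulOpposite.op (r i j) • x) :=
    fun i x => by
    rw [Finset.univ_sum_single fun j => MulOpposite.op (r i j) • x]
    ext j
    simp only [α, LinearMap.pi_apply, LinearMap.sum_apply, LinearMap.comp_apply,
      LinearMap.proj_apply]
    rw [Finset.sum_eq_single i (fun l _ hl => by rw [Pi.single_eq_of_ne hl, map_zero]) (by simp),
      Pi.single_eq_same]
    rfl
  obtain ⟨χ, hχ⟩ := hg.exists_extension hf ex α
    (LinearMap.lsum S (fun _ : Fin q => K) ℕ fun j => (ξ j).hom)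
    (LinearMap.lsum S (fun _ : Fin p => K) ℕ fun i => (ψ i).hom) (by
      refine LinearMap.pi_ext fun i x => ?_
      have h1 := congrArg (fun θ => θ.hom x) (hξ i)
      simp only [bimodHomMap_hom_apply, BimodHom.hom_sum, LinearMap.sum_apply,
        BimodHom.smul_hom_apply] at h1
      simp only [LinearMap.comp_apply, hα, map_sum, LinearMap.lsum_piSingle, h1])
  have hψ : ∀ i, ψ i = ∑ j, r i j • BimodHom.of S R K (χ ∘ₗ LinearMap.single S (fun _ => K) j) :=
    fun i => BimodHom.ext S R K fun x => by
      have h1 := LinearMap.congr_fun hχ (Pi.single i x)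
      rw [LinearMap.lsum_piSingle, LinearMap.comp_apply, hα, map_sum] at h1
      rw [BimodHom.hom_sum, LinearMap.sum_apply, ← h1]
      rfl
  simp only [hψ, balTmul_sum, ← op_smul_balTmul]
  rw [Finset.sum_comm]
  refine Finset.sum_eq_zero fun j _ => ?_
  rw [← sum_balTmul]
  have : ∑ i, MulOpposite.op (r i j) • ρ (Pi.single i 1) = ρ (γ (Pi.single j 1)) := by
    conv_rhs => rw [hgen p (γ (Pi.single j 1))]
    simp [r]
  rw [this, hγ.apply_apply_eq_zero, zero_balTmul]

/-- Injectivity is inherited from M because K ⊗ Hom_S(K, f) is injective, K being finitely presented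
over R^op. For surjectivity, writing f(y) = ∑ φᵢ(kᵢ) extends S → M, 1 ↦ f(y), along S → K^m, and
such an extension can be replaced by one into N. -/
theorem LiftsFinitelyPresented.counitMap_bijective [Module.FinitePresentation S K]
    [Module.FinitePresentation Rᵐᵒᵖ K] (hg : LiftsFinitelyPresented g)
    (hf : Function.Injective f) (ex : Function.Exact f g)
    (h : Function.Bijective (counitMap S R K M)) : Function.Bijective (counitMap S R K N) := by
  constructor
  · have h1 := isInjectiveOnFinitelyPresented_bimodHomMap (R := R) (K := K) hg hf ex K
    have h2 : Function.Injective (balMapL S R K (bimodHomMap R K f)) := by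
      rw [injective_iff_map_eq_zero]
      intro z hz
      have h3 : balMap ℤ ℤ R LinearMap.id (bimodHomMap R K f)
          (balMap S ℤ R LinearMap.id LinearMap.id z) = 0 := by
        have h4 := congrArg (balMap S ℤ R (LinearMap.id : K →ₗ[Rᵐᵒᵖ] K) LinearMap.id) hz
        change balMap S ℤ R LinearMap.id LinearMap.id
          (balMap S S R LinearMap.id (bimodHomMap R K f) z) = _ at h4
        rw [balMap_balMap, map_zero] at h4
        rw [balMap_balMap]
        exact h4
      have h5 := congrArg (balMap ℤ S R (LinearMap.id : K →ₗ[Rᵐᵒᵖ] K) LinearMap.id)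
        ((injective_iff_map_eq_zero _).1 h1 _ h3)
      rw [balMap_balMap, map_zero] at h5
      exact (balMap_id S R z).symm.trans h5
    rw [injective_iff_map_eq_zero]
    intro z hz
    refine (injective_iff_map_eq_zero _).1 h2 z ((injective_iff_map_eq_zero _).1 h.1 _ ?_)
    rw [counitMap_naturality, hz, map_zero]
  · intro y
    obtain ⟨m, ρ, hρ⟩ := Module.Finite.exists_fin' Rᵐᵒᵖ K
    let k : Fin m → K := fun i => ρ (Pi.single i 1)
    have hk : ∀ x, ∃ b : Fin m → Rᵐᵒᵖ, x = ∑ i, b i • k i := fun x => by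
      obtain ⟨b, rfl⟩ := hρ x
      refine ⟨b, ?_⟩
      conv_lhs => rw [← Finset.univ_sum_single b]
      rw [map_sum]
      exact Finset.sum_congr rfl fun i _ => by
        rw [← map_smul, ← Pi.single_smul, smul_eq_mul, mul_one]
    obtain ⟨w, hw⟩ := h.2 (f y)
    obtain ⟨φ, rfl⟩ := exists_eq_sum_balTmul (T := S) hk w
    obtain ⟨χ, hχ⟩ := hg.exists_extension hf ex (LinearMap.toSpanSingleton S (Fin m → K) k)
      (LinearMap.lsum S (fun _ : Fin m => K) ℕ fun i => (φ i).hom)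
      (LinearMap.toSpanSingleton S N y) (by
        ext
        simpa using hw.symm)
    have h1 := LinearMap.congr_fun hχ 1
    simp only [LinearMap.comp_apply, LinearMap.toSpanSingleton_apply, one_smul] at h1
    refine ⟨∑ i, balTmul S R (k i)
      (BimodHom.of S R K (χ ∘ₗ LinearMap.single S (fun _ => K) i)), ?_⟩
    rw [← h1]
    simp only [map_sum, counitMap_tmul, BimodHom.hom_of, LinearMap.comp_apply]
    rw [← map_sum]
    exact congrArg χ (LinearMap.sum_single_apply (fun _ => K) k)

theorem LiftsFinitelyPresented.counitMap_quotient_bijective [Module.FinitePresentation S K]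
    [Module.FinitePresentation Rᵐᵒᵖ K] (hg : LiftsFinitelyPresented g)
    (hf : Function.Injective f) (ex : Function.Exact f g)
    (h : Function.Bijective (counitMap S R K M)) : Function.Bijective (counitMap S R K Q) := by
  have hs := bimodHomMap_surjective (R := R) (K := K) hg
  constructor
  · rw [injective_iff_map_eq_zero]
    intro z hz
    obtain ⟨w, rfl⟩ := balMap_surjective S S R (f := (LinearMap.id : K →ₗ[Rᵐᵒᵖ] K))
      Function.surjective_id hs z
    change counitMap S R K Q (balMapL S R K (bimodHomMap R K g) w) = 0 at hz
    rw [counitMap_naturality] at hz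
    obtain ⟨y, hy⟩ := (ex _).1 hz
    obtain ⟨x, rfl⟩ := (hg.counitMap_bijective (R := R) hf ex h).2 y
    rw [← counitMap_naturality] at hy
    obtain rfl := h.1 hy
    exact (balMap_exact_right S S S R (bimodHomMap_exact hf ex) hs).apply_apply_eq_zero x
  · intro q
    obtain ⟨m, rfl⟩ := hg.surjective q
    obtain ⟨w, rfl⟩ := h.2 m
    exact ⟨_, counitMap_naturality g w⟩

end RelFlat

/-! ### Assembly of the main theorem. -/

theorem isPureEpi_id {A : Type u} [Ring A] {M : Type u} [AddCommGroup M] [Module A M] :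
    IsPureEpi (LinearMap.id : M →ₗ[A] M) := by
  refine ⟨Function.surjective_id, fun X _ _ => ?_⟩
  have : Subsingleton (BalTensor ℤ A X (LinearMap.ker (LinearMap.id : M →ₗ[A] M))) := by
    refine subsingleton_of_forall_eq 0 fun z => ?_
    induction z using balTensor_induction with
    | tmul x y =>
      obtain rfl : y = 0 := Subtype.ext y.2
      exact balTmul_zero ℤ A x
    | zero => rfl
    | add a b ha hb => rw [ha, hb, add_zero]
  exact Function.injective_of_subsingleton _

end

theorem mainTheorem10 (S R : Type u) [Ring S] [Ring R] (n : ℕ∞) (d : ℕ) (hd : 1 ≤ d)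
    (hn : ((d + 1 : ℕ) : ℕ∞) < n) (C : Type u) [AddCommGroup C] [Module S C] [Module Rᵐᵒᵖ C]
    [SMulCommClass S Rᵐᵒᵖ C] (K : Type u) [AddCommGroup K] [Module S K] [Module Rᵐᵒᵖ K]
    [SMulCommClass S Rᵐᵒᵖ K]
    (hK : IsSpecialSemidualizing S R d K C) :
    (∀ (M : Type u) [AddCommGroup M] [Module R M],
      IsRelNDInjective S R K n d M ↔
        (∀ N : Submodule R M, IsPureSubmodule N → IsRelNDInjective S R K n d N) ∧
        (∀ (Q : Type u) [AddCommGroup Q] [Module R Q] (g : M →ₗ[R] Q), IsPureEpi g →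
          IsRelNDInjective S R K n d Q)) ∧
    (∀ (M : Type u) [AddCommGroup M] [Module S M],
      IsRelNDFlat S R K n d M ↔
        (∀ N : Submodule S M, IsPureSubmodule N → IsRelNDFlat S R K n d N) ∧
        (∀ (Q : Type u) [AddCommGroup Q] [Module S Q] (g : M →ₗ[S] Q), IsPureEpi g →
          IsRelNDFlat S R K n d Q)) := by
  have hS : Module.FinitePresentation S K :=
    IsFinitelyNPresented.finitePresentation (n := ⊤) hK.syzygy_left.isFinitelyNPresented
  have hR : Module.FinitePresentation Rᵐᵒᵖ K :=
    IsFinitelyNPresented.finitePresentation (n := ⊤) hK.syzygy_right.isFinitelyNPresented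
  -- The backward implications hold because M is a pure epimorphic image of itself.
  refine ⟨fun M _ _ => ⟨fun hM => ?_, fun h => h.2 M LinearMap.id isPureEpi_id⟩,
    fun M _ _ => ⟨fun hM => ?_, fun h => h.2 M LinearMap.id isPureEpi_id⟩⟩
  · obtain ⟨hu, hI⟩ := hM.exists_counit fun I _ _ hI => hK.counitMap_bijective hI
    refine ⟨fun N hN => ?_, fun Q _ _ g hg => ?_⟩
    · have ex : Function.Exact N.subtype N.mkQ := LinearMap.exact_iff.2 (by simp)
      have hq := Submodule.mkQ_surjective N
      exact isRelNDInjective_of_unitMap (hN.unitMap_bijective hu)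
        (hI.of_injective hn (hN.balMapL_liftsFinitelyPresented ex hq) hN.balMapL_injective
          (balMap_exact_right S S S R ex hq))
    · have ex := LinearMap.exact_subtype_ker_map g
      exact isRelNDInjective_of_unitMap (hg.2.unitMap_quotient_bijective hu ex hg.1)
        (hI.of_liftsFinitelyPresented hn (hg.2.balMapL_liftsFinitelyPresented ex hg.1))
  · obtain ⟨hc, hF⟩ := hM.exists_unit hn fun F _ _ hF => hK.unitMap_bijective hF
    refine ⟨fun N hN => ?_, fun Q _ _ g hg => ?_⟩
    · have ex : Function.Exact N.subtype N.mkQ := LinearMap.exact_iff.2 (by simp)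
      have hq := hN.liftsFinitelyPresented ex (Submodule.mkQ_surjective N)
      have hf := Submodule.subtype_injective N
      exact isRelNDFlat_of_counitMap (hq.counitMap_bijective hf ex hc)
        (hF.of_injective hn (isInjectiveOnFinitelyPresented_bimodHomMap hq hf ex))
    · have ex := LinearMap.exact_subtype_ker_map g
      have hq := hg.2.liftsFinitelyPresented ex hg.1
      have hf := Submodule.subtype_injective (LinearMap.ker g)
      exact isRelNDFlat_of_counitMap (hq.counitMap_quotient_bijective hf ex hc)
        (hF.of_surjective hn (isInjectiveOnFinitelyPresented_bimodHomMap hq hf ex)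
          (bimodHomMap_exact hf ex) (bimodHomMap_surjective hq))
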